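/- Let $L$ be a first-order signature; models are $L$-structures with nonempty domain. Second-order logic (SO) over $L$ has first-order variables and function and relation variables of all finite arities, quantification over each of these, and its standard (full) semantics. A sentence has no free variables of any kind. BID-logic over $L$ has the formulas $$\phi ::= \alpha \mid {=}(t_1,\dots,t_n) \mid \neg{=}(t_1,\dots,t_n) \mid \bot \mid \phi\wedge\phi \mid \phi\otimes\phi \mid \phi\sqcup\phi \mid \phi\to\phi \mid \phi\multimap\phi \mid \forall x\phi \mid \exists x\phi,$$ where $\otimes$ is split disjunction, $\sqcup$ intuitionistic disjunction, $\to$ intuitionistic implication, $\multimap$ linear implication, $\alpha$ is a first-order atomic or negated atomic formula, $n\ge 1$ and the $t_i$ are terms. A team $X$ of $M$ is a set of assignments in $M$ with a common finite domain $\mathrm{dom}(X)$ of variables, and, for $\mathrm{dom}(X)$ containing the free variables of the formula: - $M\models_X\alpha$ iff every $s\in X$ satisfies $\alpha$; - $M\models_X{=}(t_1,\dots,t_n)$ iff any $s,s'\in X$ that agree on $t_1,\dots,t_{n-1}$ agree on $t_n$; - $M\models_X\neg{=}(t_1,\dots,t_n)$ iff $M\models_X\bot$ iff $X=\emptyset$;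 - $M\models_X\phi\wedge\psi$ iff $M\models_X\phi$ and $M\models_X\psi$; - $M\models_X\phi\otimes\psi$ iff $X=Y\cup Z$ for some teams $Y,Z$ with $M\models_Y\phi$ and $M\models_Z\psi$; - $M\models_X\phi\sqcup\psi$ iff $M\models_X\phi$ or $M\models_X\psi$; - $M\models_X\phi\to\psi$ iff for every $Y\subseteq X$, $M\models_Y\phi$ implies $M\models_Y\psi$; - $M\models_X\phi\multimap\psi$ iff for every team $Y$ with $\mathrm{dom}(Y)=\mathrm{dom}(X)$, $M\models_Y\phi$ implies $M\models_{X\cup Y}\psi$; - $M\models_X\exists x\phi$ iff there is $F:X\to M$ such that $\{s(F(s)/x): s\in X\}$ satisfies $\phi$; - $M\models_X\forall x\phi$ iff $\{s(a/x): s\in X,\ a\in M\}$ satisfies $\phi$. A BID sentence $\phi$ (no free variables) is true in $M$ if $M\models_{\{\emptyset\}}\phi$, where $\{\emptyset\}$ is the team whose only member is the empty assignment. **Statement.** (1) SO sentences are expressible in BID-logic: for every SO sentence $\phi$ over $L$ there is a BID sentence $\phi'$ over $L$ such that for every model $M$, $M\models\phi$ if and only if $M\models_{\{\emptyset\}}\phi'$.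 (2) For sentences in normal form the translation is explicit. Let $\phi$ be an SO sentence $$\forall f^1_1\dots\forall f^1_p\,\exists f^2_1\dots\exists f^2_p\ \dots\ \forall f^{2n-1}_1\dots\forall f^{2n-1}_p\,\exists f^{2n}_1\dots\exists f^{2n}_p\,\forall x_1\dots\forall x_m\,\psi,$$ where $\psi$ is quantifier-free, the $f^i_j$ are distinct $q$-ary function variables, and for each $i,j$ every occurrence of $f^i_j$ in $\psi$ is of the form $f^i_j\mathbf{x}^{i,j}$ for one fixed $q$-tuple $\mathbf{x}^{i,j}$ of variables from $\{x_1,\dots,x_m\}$. Let $u_{i,j}$ ($1\le i\le 2n$, $1\le j\le p$) be distinct first-order variables not occurring in $\phi$. Put $\Theta_i=\bigwedge_{j=1}^p {=}(\mathbf{x}^{i,j},u_{i,j})$; let $\psi'$ be obtained from $\psi$, written in negation normal form, by replacing each $f^i_j\mathbf{x}^{i,j}$ by $u_{i,j}$ and $\vee$ by $\otimes$. Put $\delta_{2n+1}=\psi'$ and, for $2n\ge i\ge 1$, $$\delta_i=\begin{cases}\Theta_i\to\delta_{i+1} & i\text{ odd},\\ \exists u_{i,1}\dots\exists u_{i,p}(\Theta_i\wedge\delta_{i+1})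 & i \text{ even}.\end{cases}$$ Then $$\phi^*=\forall u_{1,1}\dots\forall u_{1,p}\,\forall u_{3,1}\dots\forall u_{3,p}\ \dots\ \forall u_{2n-1,1}\dots\forall u_{2n-1,p}\,\forall x_1\dots\forall x_m\,\delta_1$$ is a BID sentence, and for every model $M$, $M\models\phi$ if and only if $M\models_{\{\emptyset\}}\phi^*$. -/

import Mathlib

/-!
# Second-order logic and BID-logic over a first-order signature

First-order variables are natural numbers. A `q`-ary function variable (and likewise a `q`-ary
relation variable) is given by its arity `q` and its index `k : ℕ`.
-/

universe u v w

namespace TeamLogic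

/-! ## Second-order logic with full (standard) semantics -/

/-- Terms of second-order logic: variables, applications of function symbols of `L`, and
applications of function variables. -/
inductive SOTerm (L : FirstOrder.Language.{u, v}) : Type u
  | var (x : ℕ) : SOTerm L
  | fn {n : ℕ} (f : L.Functions n) (ts : Fin n → SOTerm L) : SOTerm L
  | app {q : ℕ} (k : ℕ) (ts : Fin q → SOTerm L) : SOTerm L

/-- Formulas of second-order logic over `L`, with quantification over elements, functions and
relations of all finite arities. -/
inductive SOFormula (L : FirstOrder.Language.{u, v}) : Type (max u v)
  | eq (t₁ t₂ : SOTerm L) : SOFormula L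
  | rel {n : ℕ} (R : L.Relations n) (ts : Fin n → SOTerm L) : SOFormula L
  | relVar {q : ℕ} (k : ℕ) (ts : Fin q → SOTerm L) : SOFormula L
  | not (φ : SOFormula L) : SOFormula L
  | and (φ χ : SOFormula L) : SOFormula L
  | or (φ χ : SOFormula L) : SOFormula L
  | all (x : ℕ) (φ : SOFormula L) : SOFormula L
  | ex (x : ℕ) (φ : SOFormula L) : SOFormula L
  | allFun (q k : ℕ) (φ : SOFormula L) : SOFormula L
  | exFun (q k : ℕ) (φ : SOFormula L) : SOFormula L
  | allRel (q k : ℕ) (φ : SOFormula L) : SOFormula L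
  | exRel (q k : ℕ) (φ : SOFormula L) : SOFormula L

/-- A valuation of all first-order, function and relation variables in `M`. -/
structure SOValuation (M : Type w) where
  /-- values of the first-order variables -/
  elem : ℕ → M
  /-- values of the function variables -/
  func : (q : ℕ) → ℕ → (Fin q → M) → M
  /-- values of the relation variables -/
  pred : (q : ℕ) → ℕ → (Fin q → M) → Prop

namespace SOValuation

variable {M : Type w}

/-- Change the value of the first-order variable `x` to `a`. -/
def setElem (A : SOValuation M) (x : ℕ) (a : M) : SOValuation M :=
  { A with elem := Function.update A.elem x a }

/-- Change the value of the `k`-th `q`-ary function variable to `F`. -/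
def setFunc (A : SOValuation M) (q k : ℕ) (F : (Fin q → M) → M) : SOValuation M :=
  { A with func := Function.update A.func q (Function.update (A.func q) k F) }

/-- Change the value of the `k`-th `q`-ary relation variable to `P`. -/
def setPred (A : SOValuation M) (q k : ℕ) (P : (Fin q → M) → Prop) : SOValuation M :=
  { A with pred := Function.update A.pred q (Function.update (A.pred q) k P) }

end SOValuation

namespace SOTerm

variable {L : FirstOrder.Language.{u, v}}

/-- The value of a term. -/
def realize {M : Type w} [L.Structure M] (A : SOValuation M) : SOTerm L → M
  | var x => A.elem x
  | fn f ts => FirstOrder.Language.Structure.funMap f fun i => (ts i).realize A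
  | app (q := q) k ts => A.func q k fun i => (ts i).realize A

/-- The first-order variables occurring in a term. -/
def vars : SOTerm L → Set ℕ
  | var x => {x}
  | fn _ ts => ⋃ i, (ts i).vars
  | app _ ts => ⋃ i, (ts i).vars

/-- The occurrences of function variables in a term: `⟨q, k, ts⟩` is a member when the `k`-th
`q`-ary function variable occurs in the term applied to the argument tuple `ts`. -/
def apps : SOTerm L → Set (Σ q : ℕ, ℕ × (Fin q → SOTerm L))
  | var _ => ∅
  | fn _ ts => ⋃ i, (ts i).apps
  | app (q := q) k ts => {⟨q, k, ts⟩} ∪ ⋃ i, (ts i).apps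

/-- The function variables `(q, k)` occurring in a term. -/
def funVars (t : SOTerm L) : Set (ℕ × ℕ) :=
  {g | ∃ ts : Fin g.1 → SOTerm L, ⟨g.1, g.2, ts⟩ ∈ t.apps}

end SOTerm

namespace SOFormula

variable {L : FirstOrder.Language.{u, v}}

/-- Standard semantics: second-order quantifiers range over all functions and relations. -/
def Realize {M : Type w} [L.Structure M] : SOFormula L → SOValuation M → Prop
  | eq t₁ t₂, A => t₁.realize A = t₂.realize A
  | rel R ts, A => FirstOrder.Language.Structure.RelMap R fun i => (ts i).realize A
  | relVar (q := q) k ts, A => A.pred q k fun i => (ts i).realize A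
  | not φ, A => ¬ φ.Realize A
  | and φ χ, A => φ.Realize A ∧ χ.Realize A
  | or φ χ, A => φ.Realize A ∨ χ.Realize A
  | all x φ, A => ∀ a : M, φ.Realize (A.setElem x a)
  | ex x φ, A => ∃ a : M, φ.Realize (A.setElem x a)
  | allFun q k φ, A => ∀ F : (Fin q → M) → M, φ.Realize (A.setFunc q k F)
  | exFun q k φ, A => ∃ F : (Fin q → M) → M, φ.Realize (A.setFunc q k F)
  | allRel q k φ, A => ∀ P : (Fin q → M) → Prop, φ.Realize (A.setPred q k P)
  | exRel q k φ, A => ∃ P : (Fin q → M) → Prop, φ.Realize (A.setPred q k P)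

/-- Free first-order variables. -/
def freeVars : SOFormula L → Set ℕ
  | eq t₁ t₂ => t₁.vars ∪ t₂.vars
  | rel _ ts => ⋃ i, (ts i).vars
  | relVar _ ts => ⋃ i, (ts i).vars
  | not φ => φ.freeVars
  | and φ χ => φ.freeVars ∪ χ.freeVars
  | or φ χ => φ.freeVars ∪ χ.freeVars
  | all x φ => φ.freeVars \ {x}
  | ex x φ => φ.freeVars \ {x}
  | allFun _ _ φ => φ.freeVars
  | exFun _ _ φ => φ.freeVars
  | allRel _ _ φ => φ.freeVars
  | exRel _ _ φ => φ.freeVars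

/-- Free function variables. -/
def freeFunVars : SOFormula L → Set (ℕ × ℕ)
  | eq t₁ t₂ => t₁.funVars ∪ t₂.funVars
  | rel _ ts => ⋃ i, (ts i).funVars
  | relVar _ ts => ⋃ i, (ts i).funVars
  | not φ => φ.freeFunVars
  | and φ χ => φ.freeFunVars ∪ χ.freeFunVars
  | or φ χ => φ.freeFunVars ∪ χ.freeFunVars
  | all _ φ => φ.freeFunVars
  | ex _ φ => φ.freeFunVars
  | allFun q k φ => φ.freeFunVars \ {(q, k)}
  | exFun q k φ => φ.freeFunVars \ {(q, k)}
  | allRel _ _ φ => φ.freeFunVars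
  | exRel _ _ φ => φ.freeFunVars

/-- Free relation variables. -/
def freeRelVars : SOFormula L → Set (ℕ × ℕ)
  | eq _ _ => ∅
  | rel _ _ => ∅
  | relVar (q := q) k _ => {(q, k)}
  | not φ => φ.freeRelVars
  | and φ χ => φ.freeRelVars ∪ χ.freeRelVars
  | or φ χ => φ.freeRelVars ∪ χ.freeRelVars
  | all _ φ => φ.freeRelVars
  | ex _ φ => φ.freeRelVars
  | allFun _ _ φ => φ.freeRelVars
  | exFun _ _ φ => φ.freeRelVars
  | allRel q k φ => φ.freeRelVars \ {(q, k)}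
  | exRel q k φ => φ.freeRelVars \ {(q, k)}

/-- A sentence has no free variables of any kind. -/
def IsSentence (φ : SOFormula L) : Prop :=
  φ.freeVars = ∅ ∧ φ.freeFunVars = ∅ ∧ φ.freeRelVars = ∅

/-- Truth of a sentence in `M`. (For a sentence over a nonempty `M` the valuation is
irrelevant.) -/
def TrueIn (M : Type w) [L.Structure M] (φ : SOFormula L) : Prop :=
  ∀ A : SOValuation M, φ.Realize A

/-- Quantifier-free formulas. -/
def IsQF : SOFormula L → Prop
  | eq _ _ => True
  | rel _ _ => True
  | relVar _ _ => True
  | not φ => φ.IsQF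
  | and φ χ => φ.IsQF ∧ χ.IsQF
  | or φ χ => φ.IsQF ∧ χ.IsQF
  | all _ _ => False
  | ex _ _ => False
  | allFun _ _ _ => False
  | exFun _ _ _ => False
  | allRel _ _ _ => False
  | exRel _ _ _ => False

/-- All occurrences of function variables in a formula, with their argument tuples. -/
def apps : SOFormula L → Set (Σ q : ℕ, ℕ × (Fin q → SOTerm L))
  | eq t₁ t₂ => t₁.apps ∪ t₂.apps
  | rel _ ts => ⋃ i, (ts i).apps
  | relVar _ ts => ⋃ i, (ts i).apps
  | not φ => φ.apps
  | and φ χ => φ.apps ∪ χ.apps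
  | or φ χ => φ.apps ∪ χ.apps
  | all _ φ => φ.apps
  | ex _ φ => φ.apps
  | allFun _ _ φ => φ.apps
  | exFun _ _ φ => φ.apps
  | allRel _ _ φ => φ.apps
  | exRel _ _ φ => φ.apps

/-- `∀ x₁ … ∀ xₘ φ`. -/
def alls (xs : List ℕ) (φ : SOFormula L) : SOFormula L := xs.foldr all φ

/-- `∀ f₁ … ∀ f_p φ` for `q`-ary function variables. -/
def allFuns (q : ℕ) (ks : List ℕ) (φ : SOFormula L) : SOFormula L := ks.foldr (allFun q) φ

/-- `∃ f₁ … ∃ f_p φ` for `q`-ary function variables. -/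
def exFuns (q : ℕ) (ks : List ℕ) (φ : SOFormula L) : SOFormula L := ks.foldr (exFun q) φ

/-- The prefix `Qᵢ fⁱ … Q_{i+r-1} f^{i+r-1}` of `r` blocks of `p` function quantifiers each,
starting with block `i`; a block is universal if its number is odd and existential if it is
even. -/
def funPrefix {p : ℕ} (q : ℕ) (f : ℕ → Fin p → ℕ) (χ : SOFormula L) : (r i : ℕ) → SOFormula L
  | 0, _ => χ
  | r + 1, i =>
    if Odd i then allFuns q (List.ofFn (f i)) (funPrefix q f χ r (i + 1))
    else exFuns q (List.ofFn (f i)) (funPrefix q f χ r (i + 1))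

end SOFormula

/-! ## BID-logic with team semantics -/

/-- Formulas of BID-logic over `L`, in negation normal form. `dep ts t` is the dependence atom
`=(ts 0, …, ts (n-1), t)` and `ndep ts t` is its negation. -/
inductive BIDFormula (L : FirstOrder.Language.{u, v}) : Type (max u v)
  | eq (t₁ t₂ : L.Term ℕ) : BIDFormula L
  | neq (t₁ t₂ : L.Term ℕ) : BIDFormula L
  | rel {n : ℕ} (R : L.Relations n) (ts : Fin n → L.Term ℕ) : BIDFormula L
  | nrel {n : ℕ} (R : L.Relations n) (ts : Fin n → L.Term ℕ) : BIDFormula L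
  | dep {n : ℕ} (ts : Fin n → L.Term ℕ) (t : L.Term ℕ) : BIDFormula L
  | ndep {n : ℕ} (ts : Fin n → L.Term ℕ) (t : L.Term ℕ) : BIDFormula L
  | bot : BIDFormula L
  | and (φ χ : BIDFormula L) : BIDFormula L
  /-- split disjunction -/
  | split (φ χ : BIDFormula L) : BIDFormula L
  /-- intuitionistic disjunction -/
  | ior (φ χ : BIDFormula L) : BIDFormula L
  /-- intuitionistic implication -/
  | imp (φ χ : BIDFormula L) : BIDFormula L
  /-- linear implication -/
  | limp (φ χ : BIDFormula L) : BIDFormula L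
  | all (x : ℕ) (φ : BIDFormula L) : BIDFormula L
  | ex (x : ℕ) (φ : BIDFormula L) : BIDFormula L

/-- Assignments on `M` with finite domain `D`. -/
abbrev Assignment (M : Type w) (D : Finset ℕ) : Type w := D → M

/-- Teams of `M` with domain `D`. -/
abbrev Team (M : Type w) (D : Finset ℕ) : Type w := Set (Assignment M D)

namespace Assignment

variable {M : Type w} {D : Finset ℕ}

/-- The assignment `s(a/x)`, with domain `D ∪ {x}`. -/
def update (s : Assignment M D) (x : ℕ) (a : M) : Assignment M (insert x D) := fun y =>
  if h : y.1 = x then a else s ⟨y.1, Finset.mem_of_mem_insert_of_ne y.2 h⟩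

/-- The value of a term under an assignment. The arbitrary value used for variables outside the
domain plays no role when the domain contains all variables of the term. -/
noncomputable def value {L : FirstOrder.Language.{u, v}} [L.Structure M] [Nonempty M]
    (s : Assignment M D) (t : L.Term ℕ) : M :=
  t.realize fun x => if h : x ∈ D then s ⟨x, h⟩ else Classical.arbitrary M

end Assignment

namespace Team

variable {M : Type w} {D : Finset ℕ}

/-- The supplement team `X(F/x)`. -/
def supplement (X : Team M D) (x : ℕ) (F : X → M) : Team M (insert x D) :=
  {s' | ∃ s : X, s' = Assignment.update s.1 x (F s)}

/-- The duplicate team `X(M/x)`. -/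
def duplicate (X : Team M D) (x : ℕ) : Team M (insert x D) :=
  {s' | ∃ s ∈ X, ∃ a : M, s' = Assignment.update s x a}

end Team

namespace BIDFormula

variable {L : FirstOrder.Language.{u, v}}

/-- Team semantics: `φ.Sat D X` says that the team `X` with domain `D` satisfies `φ`. It is meant
for domains that contain all free variables of `φ`. -/
def Sat {M : Type w} [L.Structure M] [Nonempty M] :
    BIDFormula L → (D : Finset ℕ) → Team M D → Prop
  | eq t₁ t₂, _, X => ∀ s ∈ X, s.value t₁ = s.value t₂
  | neq t₁ t₂, _, X => ∀ s ∈ X, s.value t₁ ≠ s.value t₂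
  | rel R ts, _, X => ∀ s ∈ X, FirstOrder.Language.Structure.RelMap R fun i => s.value (ts i)
  | nrel R ts, _, X => ∀ s ∈ X, ¬ FirstOrder.Language.Structure.RelMap R fun i => s.value (ts i)
  | dep ts t, _, X => ∀ s ∈ X, ∀ s' ∈ X,
      (∀ i, s.value (ts i) = s'.value (ts i)) → s.value t = s'.value t
  | ndep _ _, _, X => X = ∅
  | bot, _, X => X = ∅
  | and φ χ, D, X => φ.Sat D X ∧ χ.Sat D X
  | split φ χ, D, X => ∃ Y Z : Team M D, X = Y ∪ Z ∧ φ.Sat D Y ∧ χ.Sat D Z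
  | ior φ χ, D, X => φ.Sat D X ∨ χ.Sat D X
  | imp φ χ, D, X => ∀ Y : Team M D, Y ⊆ X → φ.Sat D Y → χ.Sat D Y
  | limp φ χ, D, X => ∀ Y : Team M D, φ.Sat D Y → χ.Sat D (X ∪ Y)
  | all x φ, D, X => φ.Sat (insert x D) (X.duplicate x)
  | ex x φ, D, X => ∃ F : X → M, φ.Sat (insert x D) (X.supplement x F)

/-- Free variables. -/
def freeVars : BIDFormula L → Set ℕ
  | eq t₁ t₂ => ↑t₁.varFinset ∪ ↑t₂.varFinset
  | neq t₁ t₂ => ↑t₁.varFinset ∪ ↑t₂.varFinset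
  | rel _ ts => ⋃ i, ↑(ts i).varFinset
  | nrel _ ts => ⋃ i, ↑(ts i).varFinset
  | dep ts t => (⋃ i, ↑(ts i).varFinset) ∪ ↑t.varFinset
  | ndep ts t => (⋃ i, ↑(ts i).varFinset) ∪ ↑t.varFinset
  | bot => ∅
  | and φ χ => φ.freeVars ∪ χ.freeVars
  | split φ χ => φ.freeVars ∪ χ.freeVars
  | ior φ χ => φ.freeVars ∪ χ.freeVars
  | imp φ χ => φ.freeVars ∪ χ.freeVars
  | limp φ χ => φ.freeVars ∪ χ.freeVars
  | all x φ => φ.freeVars \ {x}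
  | ex x φ => φ.freeVars \ {x}

/-- A sentence has no free variables. -/
def IsSentence (φ : BIDFormula L) : Prop := φ.freeVars = ∅

/-- Truth of a sentence in `M`: the team `{∅}`, whose only member is the empty assignment,
satisfies it. -/
def TrueIn (M : Type w) [L.Structure M] [Nonempty M] (φ : BIDFormula L) : Prop :=
  φ.Sat ∅ ({fun x => absurd x.2 (Finset.notMem_empty x.1)} : Team M ∅)

/-- `∀ x₁ … ∀ xₘ φ`. -/
def alls (xs : List ℕ) (φ : BIDFormula L) : BIDFormula L := xs.foldr all φ

/-- `∃ x₁ … ∃ xₘ φ`. -/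
def exs (xs : List ℕ) (φ : BIDFormula L) : BIDFormula L := xs.foldr ex φ

/-- Finite conjunctions; the empty one is the formula `⊥ → ⊥`, which every team satisfies. -/
def conj : List (BIDFormula L) → BIDFormula L
  | [] => imp bot bot
  | [φ] => φ
  | φ :: χ :: l => and φ (conj (χ :: l))

end BIDFormula

/-! ## The translation -/

/-- Replace every occurrence of an application of the function variable with index `k` by the
first-order variable `y k`. -/
def SOTerm.replace {L : FirstOrder.Language.{u, v}} (y : ℕ → ℕ) : SOTerm L → L.Term ℕ
  | .var x => .var x
  | .fn f ts => .func f fun i => (ts i).replace y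
  | .app k _ => .var (y k)

/-- For a quantifier-free formula `ψ` without relation variables, `ψ.replace y true` is the
first-order formula of BID-logic obtained from `ψ` by replacing applications of function
variables as above and reading `∨` as split disjunction; `ψ.replace y false` is the same for the
negation of `ψ`. Negations are pushed to the atoms, since formulas of BID-logic are in negation
normal form. The value on other formulas is irrelevant. -/
def SOFormula.replace {L : FirstOrder.Language.{u, v}} (y : ℕ → ℕ) : SOFormula L → Bool → BIDFormula L
  | .eq t₁ t₂, true => .eq (t₁.replace y) (t₂.replace y)
  | .eq t₁ t₂, false => .neq (t₁.replace y) (t₂.replace y)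
  | .rel R ts, true => .rel R fun i => (ts i).replace y
  | .rel R ts, false => .nrel R fun i => (ts i).replace y
  | .not φ, b => φ.replace y (!b)
  | .and φ χ, true => .and (φ.replace y true) (χ.replace y true)
  | .and φ χ, false => .split (φ.replace y false) (χ.replace y false)
  | .or φ χ, true => .split (φ.replace y true) (χ.replace y true)
  | .or φ χ, false => .and (φ.replace y false) (χ.replace y false)
  | _, _ => .bot

/-- Second-order sentences of the form
`∀f¹₁…∀f¹_p ∃f²₁…∃f²_p … ∀f^{2n-1}₁…∀f^{2n-1}_p ∃f^{2n}₁…∃f^{2n}_p ∀x₁…∀xₘ ψ`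
with `ψ` quantifier-free, in which every occurrence of the `q`-ary function variable `fⁱⱼ` is of
the same form `fⁱⱼ xⁱʲ` for a fixed tuple `xⁱʲ` of variables from `x₁, …, xₘ`. The blocks are
numbered `1, …, 2n`; the values of `f` and `arg` at other numbers are not used. -/
structure NormalForm (L : FirstOrder.Language.{u, v}) where
  /-- half the number of blocks of function quantifiers -/
  n : ℕ
  /-- the number of function quantifiers in each block -/
  p : ℕ
  /-- the arity of the function variables -/
  q : ℕ
  /-- the list `x₁, …, xₘ` -/
  xs : List ℕ
  /-- `f i j` is the index of the function variable `fⁱⱼ` -/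
  f : ℕ → Fin p → ℕ
  /-- `arg i j` is the tuple `xⁱʲ` -/
  arg : ℕ → Fin p → Fin q → ℕ
  /-- the quantifier-free part -/
  ψ : SOFormula L
  qf : ψ.IsQF
  xs_nodup : xs.Nodup
  f_inj : ∀ i ∈ Set.Icc 1 (2 * n), ∀ i' ∈ Set.Icc 1 (2 * n), ∀ j j',
    f i j = f i' j' → i = i' ∧ j = j'
  arg_mem : ∀ i ∈ Set.Icc 1 (2 * n), ∀ j k, arg i j k ∈ xs
  uniform : ∀ i ∈ Set.Icc 1 (2 * n), ∀ j, ∀ ts : Fin q → SOTerm L,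
    ⟨q, f i j, ts⟩ ∈ ψ.apps → ts = fun k => SOTerm.var (arg i j k)
  closed : (SOFormula.funPrefix q f (SOFormula.alls xs ψ) (2 * n) 1).IsSentence

namespace NormalForm

variable {L : FirstOrder.Language.{u, v}}

/-- The second-order sentence itself. -/
def toFormula (N : NormalForm L) : SOFormula L :=
  SOFormula.funPrefix N.q N.f (SOFormula.alls N.xs N.ψ) (2 * N.n) 1

/-- `y` assigns to the function variables `fⁱⱼ` pairwise distinct first-order variables
`u_{i,j} = y (fⁱⱼ)` that do not occur in the sentence (whose first-order variables are exactly
`x₁, …, xₘ`). -/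
def Fresh (N : NormalForm L) (y : ℕ → ℕ) : Prop :=
  (∀ i ∈ Set.Icc 1 (2 * N.n), ∀ j, y (N.f i j) ∉ N.xs) ∧
  ∀ i ∈ Set.Icc 1 (2 * N.n), ∀ i' ∈ Set.Icc 1 (2 * N.n), ∀ j j',
    y (N.f i j) = y (N.f i' j') → i = i' ∧ j = j'

/-- The list `u_{i,1}, …, u_{i,p}`. -/
def us (N : NormalForm L) (y : ℕ → ℕ) (i : ℕ) : List ℕ := List.ofFn fun j => y (N.f i j)

/-- `Θᵢ`, the conjunction of the dependence atoms `=(xⁱʲ, u_{i,j})` for `j = 1, …, p`. -/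
def theta (N : NormalForm L) (y : ℕ → ℕ) (i : ℕ) : BIDFormula L :=
  BIDFormula.conj (List.ofFn fun j =>
    BIDFormula.dep (fun k => FirstOrder.Language.Term.var (N.arg i j k)) (FirstOrder.Language.Term.var (y (N.f i j))))

/-- `N.delta y r i` is the formula `δᵢ` when `r` is the number of blocks from block `i` on, that
is, when `i + r = 2n + 1`: it is `Θᵢ → δᵢ₊₁` for odd `i` and `∃u_{i,1}…∃u_{i,p}(Θᵢ ∧ δᵢ₊₁)` for
even `i`, where the role of `δ_{2n+1}` is played by `ψ'`. -/
def delta (N : NormalForm L) (y : ℕ → ℕ) : (r i : ℕ) → BIDFormula L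
  | 0, _ => N.ψ.replace y true
  | r + 1, i =>
    if Odd i then BIDFormula.imp (N.theta y i) (N.delta y r (i + 1))
    else BIDFormula.exs (N.us y i) (BIDFormula.and (N.theta y i) (N.delta y r (i + 1)))

/-- The sentence `φ* = ∀u₁ ∀u₃ … ∀u_{2n-1} ∀x₁ … ∀xₘ δ₁`. -/
def star (N : NormalForm L) (y : ℕ → ℕ) : BIDFormula L :=
  BIDFormula.alls ((List.range N.n).flatMap fun t => N.us y (2 * t + 1))
    (BIDFormula.alls N.xs (N.delta y (2 * N.n) 1))

end NormalForm

end TeamLogic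

/-! A team can store a function: if the argument variables take all tuples of values in the team and
the value of `u` depends on them, the team carries the graph of exactly one function. Given such
argument variables, `∃u (=(args, u) ∧ φ)` chooses a function. Dually, `∀u (=(args, u) → φ)` speaks
of all subteams on which `u` is a function of the arguments. All formulas are downward closed
(`Holds.mono`), so among these only the maximal subteams matter, and they are the graphs of total
functions. Thus both formulas are full second-order quantifiers (`holds_exDep`, `holds_allDep`).

For arbitrary sentences, each function variable gets its own argument variables, universally
quantified just before. First-order variables are the case of arity 0, i.e. they are constant on the
team. A representing team then describes a single valuation, and the translated formula has one
classical truth value there. Hence `⊔` serves as disjunction and negation can be pushed to the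
atoms. Terms are evaluated by naming the values of their subterms by constants; an application is
looked up on the subteam where the stored arguments equal these constants. A relation is stored as
the equalizer of two functions. This misses only the empty relation on a one-point model, so the
empty relation is treated as a separate case. The induction is `SOFormula.holds_toBID`.

In the normal form all functions share the variables `x₁, …, xₘ`, and one team holds the values of
all odd `u` at once. The invariant `NormalForm.Represents` says that the blocks already treated are
graphs of the current functions, and that the remaining odd `u` and the `x` still take all
combinations of values. `holds_delta` removes one block at a time: an odd `Θᵢ` cuts the team down to
the graphs of the chosen functions, an even block adds them. What remains is `ψ'`, which is flat,
i.e. true in a team iff true at each assignment (`SOFormula.holds_replace`). -/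

namespace TeamLogic

/-- The assignment that has the values of `a` on the list `l` and those of `g` elsewhere. -/
def override {α : Type*} (l : List ℕ) (a g : ℕ → α) : ℕ → α := fun x => if x ∈ l then a x else g x

section override

variable {α : Type*} {l : List ℕ} {a g : ℕ → α} {x : ℕ}

theorem override_of_mem (h : x ∈ l) : override l a g x = a x := if_pos h

theorem override_of_notMem (h : x ∉ l) : override l a g x = g x := if_neg h

@[simp] theorem override_nil : override [] a g = g := by
  funext x; simp [override]

/-- With `override_cons`, this turns a block of successive quantifiers into one simultaneous choice
of values. The list may repeat `x`; then the innermost value wins, hence the case distinction on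
`l`. -/
theorem override_update {c : α} :
    override l a (Function.update g x c) =
      override (x :: l) (fun y => if y ∈ l then a y else c) g := by
  funext y
  by_cases h : y ∈ l
  · simp [override, h]
  · by_cases hy : y = x
    · subst hy; simp [override, h]
    · simp [override, h, hy]

theorem override_cons :
    override (x :: l) a g = override l a (Function.update g x (a x)) := by
  funext y
  by_cases h : y ∈ l
  · simp [override, h]
  · by_cases hy : y = x
    · subst hy; simp [override, h]
    · simp [override, h, hy]

end override

/-! ## Teams of total assignments -/

namespace Assignment

variable {M : Type w} [Nonempty M] {D : Finset ℕ}

/-- The extension of an assignment by an arbitrary value outside its domain. -/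
noncomputable def extend (s : Assignment M D) : ℕ → M :=
  fun x => if h : x ∈ D then s ⟨x, h⟩ else Classical.arbitrary M

theorem extend_injective : Function.Injective (extend (M := M) (D := D)) := by
  intro s s' h
  funext x
  simpa [extend] using congrFun h x.1

theorem extend_update (s : Assignment M D) (x : ℕ) (a : M) :
    (s.update x a).extend = Function.update s.extend x a := by
  funext y
  by_cases hy : y = x
  · subst hy; simp [extend, update]
  · by_cases h : y ∈ D <;> simp [extend, update, hy, h]

/-- This matches the side condition in the clause of `Holds` for linear implication, whose
quantifier over teams does not stay inside the given one. -/
theorem mem_range_extend (g : ℕ → M) :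
    g ∈ Set.range (extend (D := D)) ↔ ∀ x ∉ D, g x = Classical.arbitrary M := by
  constructor
  · rintro ⟨s, rfl⟩ x hx
    simp [extend, hx]
  · intro h
    refine ⟨fun x => g x, funext fun x => ?_⟩
    by_cases hx : x ∈ D
    · simp [extend, hx]
    · simp [extend, hx, h x hx]

end Assignment

/-- The duplicate of a team of total assignments. -/
def duplicate {M : Type w} (x : ℕ) (X : Set (ℕ → M)) : Set (ℕ → M) :=
  {s' | ∃ s ∈ X, ∃ a : M, s' = Function.update s x a}

theorem duplicate_mono {M : Type w} {x : ℕ} {X Y : Set (ℕ → M)} (h : Y ⊆ X) :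
    duplicate x Y ⊆ duplicate x X := by
  rintro _ ⟨s, hs, a, rfl⟩
  exact ⟨s, h hs, a, rfl⟩

namespace BIDFormula

variable {L : FirstOrder.Language.{u, v}}

/-- Team semantics with teams of total assignments; the set `D` only restricts the range of the
teams in the clause for linear implication. -/
def Holds {M : Type w} [L.Structure M] [Nonempty M] :
    BIDFormula L → Finset ℕ → Set (ℕ → M) → Prop
  | eq t₁ t₂, _, X => ∀ s ∈ X, t₁.realize s = t₂.realize s
  | neq t₁ t₂, _, X => ∀ s ∈ X, t₁.realize s ≠ t₂.realize s
  | rel R ts, _, X => ∀ s ∈ X, FirstOrder.Language.Structure.RelMap R fun i => (ts i).realize s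
  | nrel R ts, _, X => ∀ s ∈ X, ¬ FirstOrder.Language.Structure.RelMap R fun i => (ts i).realize s
  | dep ts t, _, X => ∀ s ∈ X, ∀ s' ∈ X,
      (∀ i, (ts i).realize s = (ts i).realize s') → t.realize s = t.realize s'
  | ndep _ _, _, X => X = ∅
  | bot, _, X => X = ∅
  | and φ χ, D, X => φ.Holds D X ∧ χ.Holds D X
  | split φ χ, D, X => ∃ Y Z, X = Y ∪ Z ∧ φ.Holds D Y ∧ χ.Holds D Z
  | ior φ χ, D, X => φ.Holds D X ∨ χ.Holds D X
  | imp φ χ, D, X => ∀ Y, Y ⊆ X → φ.Holds D Y → χ.Holds D Y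
  | limp φ χ, D, X => ∀ Y, (∀ s ∈ Y, ∀ x ∉ D, s x = Classical.arbitrary M) →
      φ.Holds D Y → χ.Holds D (X ∪ Y)
  | all x φ, D, X => φ.Holds (insert x D) (duplicate x X)
  | ex x φ, D, X => ∃ F : (ℕ → M) → M,
      φ.Holds (insert x D) ((fun s => Function.update s x (F s)) '' X)

variable {M : Type w} [L.Structure M] [Nonempty M]

/-- Extension is injective and commutes with updates, so it carries subteams, splittings, duplicates
and supplements to their counterparts. Afterwards domains need no attention. -/
theorem sat_iff_holds (φ : BIDFormula L) : ∀ (D : Finset ℕ) (X : Team M D),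
    φ.Sat D X ↔ φ.Holds D (Assignment.extend '' X) := by
  induction φ with
  | eq t₁ t₂ => intro D X; simp only [Holds, Set.forall_mem_image]; rfl
  | neq t₁ t₂ => intro D X; simp only [Holds, Set.forall_mem_image]; rfl
  | rel R ts => intro D X; simp only [Holds, Set.forall_mem_image]; rfl
  | nrel R ts => intro D X; simp only [Holds, Set.forall_mem_image]; rfl
  | dep ts t => intro D X; simp only [Holds, Set.forall_mem_image]; rfl
  | ndep ts t => intro D X; simp only [Holds, Sat, Set.image_eq_empty]
  | bot => intro D X; simp only [Holds, Sat, Set.image_eq_empty]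
  | and φ χ hφ hχ => intro D X; simp only [Holds, Sat, hφ, hχ]
  | ior φ χ hφ hχ => intro D X; simp only [Holds, Sat, hφ, hχ]
  | split φ χ hφ hχ =>
    intro D X
    simp only [Holds, Sat, hφ, hχ]
    constructor
    · rintro ⟨Y, Z, rfl, hY, hZ⟩
      exact ⟨_, _, Set.image_union _ _ _, hY, hZ⟩
    · rintro ⟨Y, Z, h, hY, hZ⟩
      obtain ⟨Y, hYX, rfl⟩ := Set.subset_image_iff.1 (h ▸ Set.subset_union_left : Y ⊆ _)
      obtain ⟨Z, hZX, rfl⟩ := Set.subset_image_iff.1 (h ▸ Set.subset_union_right : Z ⊆ _)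
      rw [← Set.image_union] at h
      exact ⟨Y, Z, Assignment.extend_injective.image_injective h, hY, hZ⟩
  | imp φ χ hφ hχ =>
    intro D X
    simp only [Holds, Sat, hφ, hχ]
    constructor
    · intro h Y hY
      obtain ⟨Y, hYX, rfl⟩ := Set.subset_image_iff.1 hY
      exact h Y hYX
    · exact fun h Y hY => h _ (Set.image_mono hY)
  | limp φ χ hφ hχ =>
    intro D X
    simp only [Holds, Sat, hφ, hχ]
    constructor
    · intro h Y hY
      obtain ⟨Y, rfl⟩ := Set.subset_range_iff_exists_image_eq.1
        fun s hs => (Assignment.mem_range_extend s).2 (hY s hs)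
      rw [← Set.image_union]
      exact h Y
    · intro h Y hY
      rw [Set.image_union]
      refine h _ ?_ hY
      rintro _ ⟨s, -, rfl⟩
      exact (Assignment.mem_range_extend _).1 ⟨s, rfl⟩
  | all x φ hφ =>
    intro D X
    simp only [Holds, Sat, hφ]
    have : Assignment.extend '' (X.duplicate x) = duplicate x (Assignment.extend '' X) := by
      ext g
      simp only [Team.duplicate, duplicate, Set.mem_image, Set.mem_ofPred_eq]
      constructor
      · rintro ⟨_, ⟨s, hs, a, rfl⟩, rfl⟩
        exact ⟨_, ⟨s, hs, rfl⟩, a, s.extend_update x a⟩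
      · rintro ⟨_, ⟨s, hs, rfl⟩, a, rfl⟩
        exact ⟨_, ⟨s, hs, a, rfl⟩, s.extend_update x a⟩
    rw [this]
  | ex x φ hφ =>
    intro D X
    simp only [Holds, Sat, hφ]
    have key : ∀ (F : X → M) (G : (ℕ → M) → M), (∀ s : X, F s = G (Assignment.extend s.1)) →
        Assignment.extend '' (X.supplement x F) =
          (fun s => Function.update s x (G s)) '' (Assignment.extend '' X) := by
      intro F G h
      ext g
      simp only [Team.supplement, Set.mem_image, Set.mem_ofPred_eq]
      constructor
      · rintro ⟨_, ⟨s, rfl⟩, rfl⟩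
        exact ⟨_, ⟨s, s.2, rfl⟩, by rw [Assignment.extend_update, h]⟩
      · rintro ⟨_, ⟨s, hs, rfl⟩, rfl⟩
        exact ⟨_, ⟨⟨s, hs⟩, rfl⟩, by rw [Assignment.extend_update, h]⟩
    constructor
    · rintro ⟨F, hF⟩
      -- The choice function is transported along the injection of `X` into total assignments; its
      -- default value off the image is never used.
      refine ⟨fun g => Function.extend (fun s : X => Assignment.extend s.1) F
        (fun _ => Classical.arbitrary M) g, ?_⟩
      rwa [← key F]
      intro s
      exact ((Assignment.extend_injective.comp Subtype.val_injective).extend_apply F _ s).symm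
    · rintro ⟨G, hG⟩
      exact ⟨fun s => G (Assignment.extend s.1), by rwa [key _ G fun _ => rfl]⟩

theorem trueIn_iff (φ : BIDFormula L) :
    φ.TrueIn M ↔ φ.Holds ∅ ({fun _ => Classical.arbitrary M} : Set (ℕ → M)) := by
  rw [TrueIn, sat_iff_holds, Set.image_singleton]
  rfl

/-! ### Downward closure and blocks of quantifiers -/

/-- Every connective preserves downward closure; for linear implication, shrinking `X` shrinks `X ∪
Y` for each fixed `Y`. This is what lets universal function quantifiers consider only maximal
subteams. -/
theorem Holds.mono {φ : BIDFormula L} : ∀ {D : Finset ℕ} {X Y : Set (ℕ → M)},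
    φ.Holds D X → Y ⊆ X → φ.Holds D Y := by
  induction φ with
  | eq t₁ t₂ => exact fun h hY s hs => h s (hY hs)
  | neq t₁ t₂ => exact fun h hY s hs => h s (hY hs)
  | rel R ts => exact fun h hY s hs => h s (hY hs)
  | nrel R ts => exact fun h hY s hs => h s (hY hs)
  | dep ts t => exact fun h hY s hs s' hs' => h s (hY hs) s' (hY hs')
  | ndep ts t => exact fun h hY => Set.subset_eq_empty hY h
  | bot => exact fun h hY => Set.subset_eq_empty hY h
  | and φ χ hφ hχ => exact fun h hY => ⟨hφ h.1 hY, hχ h.2 hY⟩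
  | ior φ χ hφ hχ => exact fun h hY => h.imp (hφ · hY) (hχ · hY)
  | split φ χ hφ hχ =>
    rintro D X Y ⟨Z, W, rfl, hZ, hW⟩ hY
    refine ⟨Y ∩ Z, Y ∩ W, ?_, hφ hZ Set.inter_subset_right, hχ hW Set.inter_subset_right⟩
    rw [← Set.inter_union_distrib_left, Set.inter_eq_left.2 hY]
  | imp φ χ hφ hχ => exact fun h hY Z hZ => h Z (hZ.trans hY)
  | limp φ χ hφ hχ =>
    exact fun h hY Z hZ hZφ => hχ (h Z hZ hZφ) (Set.union_subset_union_left _ hY)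
  | all x φ hφ => exact fun h hY => hφ h (duplicate_mono hY)
  | ex x φ hφ =>
    rintro D X Y ⟨F, hF⟩ hY
    exact ⟨F, hφ hF (Set.image_mono hY)⟩

theorem holds_conj (l : List (BIDFormula L)) (D : Finset ℕ) (X : Set (ℕ → M)) :
    (conj l).Holds D X ↔ ∀ φ ∈ l, φ.Holds D X := by
  induction l with
  | nil => simp [conj, Holds]
  | cons φ l ih =>
    cases l with
    | nil => simp [conj]
    | cons χ l => simp only [conj, Holds, ih, List.forall_mem_cons]

/-- The domain after quantification over the variables of a list. -/
def insertList (l : List ℕ) (D : Finset ℕ) : Finset ℕ := l.foldl (fun D x => insert x D) D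

theorem holds_alls (l : List ℕ) (φ : BIDFormula L) (D : Finset ℕ) (X : Set (ℕ → M)) :
    (alls l φ).Holds D X ↔
      φ.Holds (insertList l D) {s' | ∃ s ∈ X, ∃ a, s' = override l a s} := by
  induction l generalizing D X with
  | nil => simp [alls, insertList]
  | cons x l ih =>
    change (alls l φ).Holds _ _ ↔ φ.Holds (insertList l (insert x D)) _
    rw [ih]
    congr! 2
    ext s'
    constructor
    · rintro ⟨_, ⟨s, hs, c, rfl⟩, a, rfl⟩
      exact ⟨s, hs, _, override_update⟩
    · rintro ⟨s, hs, a, rfl⟩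
      exact ⟨_, ⟨s, hs, a x, rfl⟩, a, override_cons⟩

/-- The choice functions are forgotten, because the dependence atoms under the quantifiers give
functions anyway. Only the agreement of the two teams off `l` is kept. -/
theorem Holds.exists_of_exs {l : List ℕ} {φ : BIDFormula L} {D : Finset ℕ} {X : Set (ℕ → M)}
    (h : (exs l φ).Holds D X) : ∃ Y, φ.Holds (insertList l D) Y ∧
      (∀ s' ∈ Y, ∃ s ∈ X, ∀ x ∉ l, s' x = s x) ∧ ∀ s ∈ X, ∃ s' ∈ Y, ∀ x ∉ l, s' x = s x := by
  induction l generalizing D X with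
  | nil => exact ⟨X, h, fun s hs => ⟨s, hs, fun _ _ => rfl⟩, fun s hs => ⟨s, hs, fun _ _ => rfl⟩⟩
  | cons x l ih =>
    obtain ⟨F, hF⟩ := h
    obtain ⟨Y, hY, h₁, h₂⟩ := ih hF
    refine ⟨Y, hY, fun s' hs' => ?_, fun s hs => ?_⟩
    · obtain ⟨_, ⟨s, hs, rfl⟩, h⟩ := h₁ s' hs'
      refine ⟨s, hs, fun y hy => ?_⟩
      rw [List.mem_cons, not_or] at hy
      exact (h y hy.2).trans (Function.update_of_ne hy.1 _ _)
    · obtain ⟨s', hs', h⟩ := h₂ _ ⟨s, hs, rfl⟩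
      refine ⟨s', hs', fun y hy => ?_⟩
      rw [List.mem_cons, not_or] at hy
      exact (h y hy.2).trans (Function.update_of_ne hy.1 _ _)

/-- Each quantifier sees the assignment as changed by the earlier ones. By `hH` the choices ignore
all variables of the block, so successive and simultaneous updates give the same team. -/
theorem holds_exs_of_image {l : List ℕ} {φ : BIDFormula L} {D : Finset ℕ} {X : Set (ℕ → M)}
    {H : ℕ → (ℕ → M) → M} (hH : ∀ x ∈ l, ∀ s s', (∀ y ∉ l, s y = s' y) → H x s = H x s')
    (h : φ.Holds (insertList l D) ((fun s => override l (fun x => H x s) s) '' X)) :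
    (exs l φ).Holds D X := by
  induction l generalizing D X with
  | nil => simpa [insertList, exs] using h
  | cons x l ih =>
    refine ⟨H x, ih (fun y hy s s' hs => hH y (List.mem_cons_of_mem _ hy) s s' fun z hz =>
      hs z fun h => hz (List.mem_cons_of_mem _ h)) ?_⟩
    convert! h using 1
    rw [Set.image_image]
    refine Set.image_congr fun s _ => ?_
    rw [override_update]
    funext y
    by_cases hy : y ∈ x :: l
    · rw [override_of_mem hy, override_of_mem hy]
      split_ifs with hl
      · refine hH y hy _ _ fun z hz => ?_
        rw [Function.update_of_ne]
        rintro rfl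
        exact hz List.mem_cons_self
      · rw [(List.mem_cons.1 hy).resolve_right hl]
    · rw [override_of_notMem hy, override_of_notMem hy]

/-! ### Dependence atoms as function quantifiers -/

/-- `∃u (=(args, u) ∧ φ)`. -/
def exDep {q : ℕ} (args : Fin q → ℕ) (u : ℕ) (φ : BIDFormula L) : BIDFormula L :=
  ex u (and (dep (fun i => .var (args i)) (.var u)) φ)

/-- `∀u (=(args, u) → φ)`. -/
def allDep {q : ℕ} (args : Fin q → ℕ) (u : ℕ) (φ : BIDFormula L) : BIDFormula L :=
  all u (imp (dep (fun i => .var (args i)) (.var u)) φ)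

/-- A functional dependence on the tuples that occur in the team extends to a total function, with
arbitrary values on the other tuples. -/
theorem holds_dep_var {q : ℕ} {args : Fin q → ℕ} {u : ℕ} {D : Finset ℕ} {X : Set (ℕ → M)} :
    (dep (L := L) (fun i => .var (args i)) (.var u)).Holds D X ↔
      ∃ F : (Fin q → M) → M, ∀ s ∈ X, s u = F fun i => s (args i) := by
  constructor
  · intro h
    have : ∀ z : Fin q → M, ∃ c, ∀ s ∈ X, (∀ i, s (args i) = z i) → s u = c := by
      intro z
      by_cases hz : ∃ s ∈ X, ∀ i, s (args i) = z i
      · obtain ⟨s, hs, hsz⟩ := hz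
        exact ⟨s u, fun s' hs' h' => h s' hs' s hs fun i => (h' i).trans (hsz i).symm⟩
      · push Not at hz
        exact ⟨Classical.arbitrary M, fun s hs h' => absurd h' (by simpa using hz s hs)⟩
    choose F hF using this
    exact ⟨F, fun s hs => hF _ s hs fun _ => rfl⟩
  · rintro ⟨F, hF⟩ s hs s' hs' h
    simp only [FirstOrder.Language.Term.realize_var] at h ⊢
    rw [hF s hs, hF s' hs', funext h]

variable {q : ℕ} {args : Fin q → ℕ} {u : ℕ} {φ : BIDFormula L} {D : Finset ℕ} {X : Set (ℕ → M)}

theorem holds_exDep (hu : ∀ i, args i ≠ u) :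
    (exDep args u φ).Holds D X ↔ ∃ F : (Fin q → M) → M, φ.Holds (insert u D)
      ((fun s => Function.update s u (F fun i => s (args i))) '' X) := by
  constructor
  · rintro ⟨F, hF, h⟩
    obtain ⟨G, hG⟩ := holds_dep_var.1 hF
    refine ⟨G, ?_⟩
    convert h using 1
    refine Set.image_congr fun s hs => ?_
    have := hG _ ⟨s, hs, rfl⟩
    simp only [Function.update_self, Function.update_of_ne (hu _)] at this
    rw [this]
  · rintro ⟨F, h⟩
    refine ⟨_, holds_dep_var.2 ⟨F, ?_⟩, h⟩
    rintro _ ⟨s, hs, rfl⟩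
    simp only [Function.update_self, Function.update_of_ne (hu _)]

/-- The graph of any `F` is a subteam of the duplicate that satisfies the atom. Conversely, a
subteam satisfying the atom lies in the graph of some total `F`, and downward closure passes `φ` to
it. -/
theorem holds_allDep (hu : ∀ i, args i ≠ u) :
    (allDep args u φ).Holds D X ↔ ∀ F : (Fin q → M) → M, φ.Holds (insert u D)
      ((fun s => Function.update s u (F fun i => s (args i))) '' X) := by
  constructor
  · intro h F
    refine h _ ?_ (holds_dep_var.2 ⟨F, ?_⟩)
    · rintro _ ⟨s, hs, rfl⟩
      exact ⟨s, hs, _, rfl⟩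
    · rintro _ ⟨s, hs, rfl⟩
      simp only [Function.update_self, Function.update_of_ne (hu _)]
  · intro h Y hY hdep
    obtain ⟨F, hF⟩ := holds_dep_var.1 hdep
    refine (h F).mono fun s' hs' => ?_
    obtain ⟨s, hs, a, rfl⟩ := hY hs'
    have := hF _ hs'
    simp only [Function.update_self, Function.update_of_ne (hu _)] at this
    exact ⟨s, hs, by simp only [← this]⟩

/-! ## Free variables -/

theorem freeVars_finite (φ : BIDFormula L) : φ.freeVars.Finite := by
  induction φ with
  | eq t₁ t₂ => exact (Finset.finite_toSet _).union (Finset.finite_toSet _)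
  | neq t₁ t₂ => exact (Finset.finite_toSet _).union (Finset.finite_toSet _)
  | rel R ts => exact Set.finite_iUnion fun _ => Finset.finite_toSet _
  | nrel R ts => exact Set.finite_iUnion fun _ => Finset.finite_toSet _
  | dep ts t =>
    exact (Set.finite_iUnion fun _ => Finset.finite_toSet _).union (Finset.finite_toSet _)
  | ndep ts t =>
    exact (Set.finite_iUnion fun _ => Finset.finite_toSet _).union (Finset.finite_toSet _)
  | bot => exact Set.finite_empty
  | and φ χ hφ hχ => exact hφ.union hχ
  | split φ χ hφ hχ => exact hφ.union hχ
  | ior φ χ hφ hχ => exact hφ.union hχ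
  | imp φ χ hφ hχ => exact hφ.union hχ
  | limp φ χ hφ hχ => exact hφ.union hχ
  | all x φ hφ => exact hφ.sdiff
  | ex x φ hφ => exact hφ.sdiff

theorem freeVars_alls (l : List ℕ) (φ : BIDFormula L) :
    (alls l φ).freeVars = φ.freeVars \ {x | x ∈ l} := by
  induction l with
  | nil => simp [alls]
  | cons x l ih =>
    change (alls l φ).freeVars \ {x} = _
    rw [ih]
    ext y
    simp only [Set.mem_sdiff, Set.mem_ofPred_eq, Set.mem_singleton_iff, List.mem_cons]
    tauto

theorem freeVars_exs (l : List ℕ) (φ : BIDFormula L) :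
    (exs l φ).freeVars = φ.freeVars \ {x | x ∈ l} := by
  induction l with
  | nil => simp [exs]
  | cons x l ih =>
    change (exs l φ).freeVars \ {x} = _
    rw [ih]
    ext y
    simp only [Set.mem_sdiff, Set.mem_ofPred_eq, Set.mem_singleton_iff, List.mem_cons]
    tauto

end BIDFormula

/-! ## Translating second-order logic into BID-logic -/

namespace SOValuation

variable {M : Type w} (A : SOValuation M) (q k : ℕ)

theorem setFunc_func_self (F : (Fin q → M) → M) : (A.setFunc q k F).func q k = F := by
  simp [setFunc]

theorem setFunc_func_of_ne (F : (Fin q → M) → M) {q' k' : ℕ} (h : (q', k') ≠ (q, k)) :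
    (A.setFunc q k F).func q' k' = A.func q' k' := by
  by_cases hq : q' = q
  · subst hq
    have hk : k' ≠ k := by rintro rfl; exact h rfl
    simp [setFunc, hk]
  · simp [setFunc, hq]

theorem setPred_pred_self (P : (Fin q → M) → Prop) : (A.setPred q k P).pred q k = P := by
  simp [setPred]

theorem setPred_pred_of_ne (P : (Fin q → M) → Prop) {q' k' : ℕ} (h : (q', k') ≠ (q, k)) :
    (A.setPred q k P).pred q' k' = A.pred q' k' := by
  by_cases hq : q' = q
  · subst hq
    have hk : k' ≠ k := by rintro rfl; exact h rfl
    simp [setPred, hk]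
  · simp [setPred, hq]

end SOValuation

/-! ### Teams up to changes of the auxiliary variables -/

/-- Two teams have the same restrictions to the variables below `n`. -/
def AgreeBelow {M : Type w} (n : ℕ) (X X' : Set (ℕ → M)) : Prop :=
  (∀ s' ∈ X', ∃ s ∈ X, ∀ x < n, s' x = s x) ∧ ∀ s ∈ X, ∃ s' ∈ X', ∀ x < n, s' x = s x

/-- The `q` variables from `b` on take all tuples of values in the team `X`. -/
def IsFull {M : Type w} (b q : ℕ) (X : Set (ℕ → M)) : Prop :=
  ∀ z : Fin q → M, ∃ s ∈ X, ∀ i : Fin q, s (b + i) = z i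

section AgreeBelow

variable {M : Type w} {n b q : ℕ} {X X' X'' : Set (ℕ → M)}

theorem AgreeBelow.trans (h : AgreeBelow n X X') (h' : AgreeBelow n X' X'') :
    AgreeBelow n X X'' := by
  refine ⟨fun s'' hs'' => ?_, fun s hs => ?_⟩
  · obtain ⟨s', hs', h₁⟩ := h'.1 s'' hs''
    obtain ⟨s, hs, h₂⟩ := h.1 s' hs'
    exact ⟨s, hs, fun x hx => (h₁ x hx).trans (h₂ x hx)⟩
  · obtain ⟨s', hs', h₁⟩ := h.2 s hs
    obtain ⟨s'', hs'', h₂⟩ := h'.2 s' hs'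
    exact ⟨s'', hs'', fun x hx => (h₂ x hx).trans (h₁ x hx)⟩

theorem AgreeBelow.of_le {m : ℕ} (h : AgreeBelow n X X') (hm : m ≤ n) : AgreeBelow m X X' :=
  ⟨fun s' hs' => (h.1 s' hs').imp fun _ h => ⟨h.1, fun x hx => h.2 x (hx.trans_le hm)⟩,
    fun s hs => (h.2 s hs).imp fun _ h => ⟨h.1, fun x hx => h.2 x (hx.trans_le hm)⟩⟩

theorem AgreeBelow.image {f : (ℕ → M) → ℕ → M} (h : ∀ s ∈ X, ∀ x < n, f s x = s x) :
    AgreeBelow n X (f '' X) := by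
  constructor
  · rintro _ ⟨s, hs, rfl⟩
    exact ⟨s, hs, h s hs⟩
  · exact fun s hs => ⟨_, ⟨s, hs, rfl⟩, h s hs⟩

theorem IsFull.of_agreeBelow (hX : IsFull b q X) (h : AgreeBelow n X X') (hb : b + q ≤ n) :
    IsFull b q X' := by
  intro z
  obtain ⟨s, hs, hz⟩ := hX z
  obtain ⟨s', hs', h⟩ := h.2 s hs
  exact ⟨s', hs', fun i => (h _ (by omega)).trans (hz i)⟩

theorem override_range'_of_lt {a g : ℕ → M} {x m : ℕ} (h : x < n) :
    override (List.range' n m) a g x = g x :=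
  override_of_notMem (by simp only [List.mem_range'_1]; omega)

theorem override_range'_add {a g : ℕ → M} {m : ℕ} (i : Fin m) :
    override (List.range' n m) a g (n + i) = a (n + i) :=
  override_of_mem (by simp only [List.mem_range'_1]; omega)

end AgreeBelow

/-! ### Building blocks of the translation -/

namespace BIDFormula

variable {L : FirstOrder.Language.{u, v}} {M : Type w} [L.Structure M] [Nonempty M]

/-- `∃x (=(x) ∧ …)` for the variables `x` of a list. -/
def exConst (l : List ℕ) (φ : BIDFormula L) : BIDFormula L :=
  l.foldr (fun x => exDep (q := 0) Fin.elim0 x) φ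

/-- A dependence atom without arguments says that the variable is constant, so one `a` serves all
assignments of the team. -/
theorem holds_exConst (l : List ℕ) (φ : BIDFormula L) (D : Finset ℕ) (X : Set (ℕ → M)) :
    (exConst l φ).Holds D X ↔ ∃ a : ℕ → M, φ.Holds (insertList l D) (override l a '' X) := by
  induction l generalizing D X with
  | nil => simp [exConst, insertList]
  | cons x l ih =>
    change (exDep Fin.elim0 x (exConst l φ)).Holds _ _ ↔
      ∃ a, φ.Holds (insertList l (insert x D)) _
    rw [holds_exDep fun i => i.elim0]
    simp only [ih, Set.image_image]
    constructor
    · rintro ⟨F, a, h⟩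
      refine ⟨fun y => if y ∈ l then a y else F Fin.elim0, ?_⟩
      convert h using 1
      refine Set.image_congr fun s _ => ?_
      rw [override_update, Subsingleton.elim (fun i : Fin 0 => s i.elim0) Fin.elim0]
    · rintro ⟨a, h⟩
      refine ⟨fun _ => a x, a, ?_⟩
      convert h using 1
      exact Set.image_congr fun s _ => override_cons.symm

/-- Constants `n, n + 1, …` that satisfy the formulas `E i`, and then `φ`. -/
def withArgs (n : ℕ) {m : ℕ} (E : Fin m → BIDFormula L) (φ : BIDFormula L) : BIDFormula L :=
  exConst (List.range' n m) (and (conj (List.ofFn E)) φ)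

/-- By `hE` the formulas `E i` determine the constants, so the only possible choice is `z`. Since
the choice is forced, the existential form serves positive and negated formulas alike. -/
theorem holds_withArgs {n m : ℕ} {E : Fin m → BIDFormula L} {φ : BIDFormula L} {D : Finset ℕ}
    {X : Set (ℕ → M)} {z : Fin m → M} {p : Prop}
    (hE : ∀ D' X', AgreeBelow n X X' → ∀ (i : Fin m) c, (∀ s ∈ X', s (n + i) = c) →
      ((E i).Holds D' X' ↔ c = z i))
    (hφ : ∀ D' X', AgreeBelow n X X' → (∀ s ∈ X', ∀ i : Fin m, s (n + i) = z i) →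
      (φ.Holds D' X' ↔ p)) :
    (withArgs n E φ).Holds D X ↔ p := by
  have agree : ∀ a, AgreeBelow n X (override (List.range' n m) a '' X) := fun a =>
    AgreeBelow.image fun s _ x hx => override_range'_of_lt hx
  have const : ∀ a, ∀ s ∈ override (List.range' n m) a '' X, ∀ i : Fin m,
      s (n + i) = a (n + i) := by
    rintro a _ ⟨s, -, rfl⟩ i
    exact override_range'_add i
  simp only [withArgs, holds_exConst, Holds, holds_conj, List.forall_mem_ofFn_iff]
  constructor
  · rintro ⟨a, hc, h⟩
    refine (hφ _ _ (agree a) fun s hs i => ?_).1 h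
    exact (const a s hs i).trans ((hE _ _ (agree a) i _ fun s hs => const a s hs i).1 (hc i))
  · intro h
    let a : ℕ → M := fun x => if hx : x - n < m then z ⟨x - n, hx⟩ else Classical.arbitrary M
    have ha : ∀ i : Fin m, a (n + i) = z i := fun i => by simp [a]
    exact ⟨a, fun i => (hE _ _ (agree a) i _ fun s hs => const a s hs i).2 (ha i),
      (hφ _ _ (agree a) fun s hs i => (const a s hs i).trans (ha i)).2 h⟩

/-- `φ` restricted to the assignments for which the `q`-tuples from `b` and from `n` on agree. -/
def atArgs (b q n : ℕ) (φ : BIDFormula L) : BIDFormula L :=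
  imp (conj (List.ofFn fun i : Fin q => eq (.var (b + i)) (.var (n + i)))) φ

/-- Both the premise and, by `hφ`, the conclusion are flat, so it suffices to test the implication
on singleton subteams. -/
theorem holds_atArgs {b q n : ℕ} {φ : BIDFormula L} {D : Finset ℕ} {X : Set (ℕ → M)}
    {C : (ℕ → M) → Prop} (hφ : ∀ Y : Set (ℕ → M), φ.Holds D Y ↔ ∀ s ∈ Y, C s) :
    (atArgs b q n φ).Holds D X ↔ ∀ s ∈ X, (∀ i : Fin q, s (b + i) = s (n + i)) → C s := by
  simp only [atArgs, Holds, holds_conj, List.forall_mem_ofFn_iff, hφ,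
    FirstOrder.Language.Term.realize_var]
  constructor
  · intro h s hs heq
    exact h {s} (Set.singleton_subset_iff.2 hs) (fun i s' hs' => hs' ▸ heq i) s rfl
  · exact fun h Y hY heq s hs => h s (hY hs) fun i => heq i s hs

/-- A quantifier (universal if `c`, existential otherwise) over `q`-ary functions, represented by
the dependence of the variable `n + q` on the variables `n, …, n + q - 1`. -/
def quantFun (c : Bool) (n q : ℕ) (φ : BIDFormula L) : BIDFormula L :=
  alls (List.range' n q)
    (if c then allDep (fun i : Fin q => n + i) (n + q) φ
      else exDep (fun i : Fin q => n + i) (n + q) φ)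

/-- A quantifier over pairs of `q`-ary functions with the same arguments. -/
def quantFun₂ (c : Bool) (n q : ℕ) (φ : BIDFormula L) : BIDFormula L :=
  quantFun c n q
    (if c then allDep (fun i : Fin q => n + i) (n + q + 1) φ
      else exDep (fun i : Fin q => n + i) (n + q + 1) φ)

/-- Quantifying the argument variables first makes them take all tuples, so the team records all of
`F`. This needs an assignment to start from, hence `hX`. -/
theorem holds_quantFun {c : Bool} {n q : ℕ} {φ : BIDFormula L} {D : Finset ℕ}
    {X : Set (ℕ → M)} {p : ((Fin q → M) → M) → Prop} (hX : X.Nonempty)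
    (hφ : ∀ F D' X', AgreeBelow n X X' → IsFull n q X' →
      (∀ s ∈ X', s (n + q) = F fun i => s (n + i)) → (φ.Holds D' X' ↔ p F)) :
    (quantFun c n q φ).Holds D X ↔ if c then ∀ F, p F else ∃ F, p F := by
  have hne : ∀ i : Fin q, n + (i : ℕ) ≠ n + q := fun i => by omega
  have key : ∀ F D', φ.Holds D' ((fun s => Function.update s (n + q) (F fun i : Fin q =>
      s (n + i))) '' {s' | ∃ s ∈ X, ∃ a, s' = override (List.range' n q) a s}) ↔ p F := by
    intro F D'
    have h₁ : AgreeBelow n X {s' | ∃ s ∈ X, ∃ a, s' = override (List.range' n q) a s} := by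
      constructor
      · rintro _ ⟨s, hs, a, rfl⟩
        exact ⟨s, hs, fun x hx => override_range'_of_lt hx⟩
      · exact fun s hs => ⟨_, ⟨s, hs, s, rfl⟩, fun x hx => override_range'_of_lt hx⟩
    have h₂ : IsFull n q {s' | ∃ s ∈ X, ∃ a, s' = override (List.range' n q) a s} := by
      intro z
      obtain ⟨s, hs⟩ := hX
      refine ⟨_, ⟨s, hs, fun x => if hx : x - n < q then z ⟨x - n, hx⟩ else s x, rfl⟩,
        fun i => ?_⟩
      rw [override_range'_add]
      simp
    have h₃ := AgreeBelow.image (n := n + q)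
      (X := {s' | ∃ s ∈ X, ∃ a, s' = override (List.range' n q) a s})
      (f := fun s => Function.update s (n + q) (F fun i : Fin q => s (n + i)))
      fun s _ x hx => Function.update_of_ne hx.ne _ _
    refine hφ F _ _ (h₁.trans (h₃.of_le (by omega))) (h₂.of_agreeBelow h₃ le_rfl) ?_
    rintro _ ⟨s, -, rfl⟩
    simp only [Function.update_self, Function.update_of_ne (hne _)]
  cases c
  · simp only [quantFun, holds_alls, Bool.false_eq_true, if_false, holds_exDep hne, key]
  · simp only [quantFun, holds_alls, if_true, holds_allDep hne, key]

/-- The second function shares the arguments of the first, so equality of the two values can be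
tested within one assignment. -/
theorem holds_quantFun₂ {c : Bool} {n q : ℕ} {φ : BIDFormula L} {D : Finset ℕ}
    {X : Set (ℕ → M)} {p : ((Fin q → M) → M) → ((Fin q → M) → M) → Prop} (hX : X.Nonempty)
    (hφ : ∀ F G D' X', AgreeBelow n X X' → IsFull n q X' →
      (∀ s ∈ X', s (n + q) = F fun i => s (n + i)) →
      (∀ s ∈ X', s (n + q + 1) = G fun i => s (n + i)) → (φ.Holds D' X' ↔ p F G)) :
    (quantFun₂ c n q φ).Holds D X ↔ if c then ∀ F G, p F G else ∃ F G, p F G := by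
  have hne : ∀ i : Fin q, n + (i : ℕ) ≠ n + q + 1 := fun i => by omega
  have key : ∀ F G D' X', AgreeBelow n X X' → IsFull n q X' →
      (∀ s ∈ X', s (n + q) = F fun i => s (n + i)) →
      (φ.Holds D' ((fun s => Function.update s (n + q + 1) (G fun i : Fin q =>
        s (n + i))) '' X') ↔ p F G) := by
    intro F G D' X' h₁ h₂ h₃
    have h₄ := AgreeBelow.image (n := n + q) (X := X')
      (f := fun s => Function.update s (n + q + 1) (G fun i : Fin q => s (n + i)))
      fun s _ x hx => Function.update_of_ne (by omega) _ _
    refine hφ F G _ _ (h₁.trans (h₄.of_le (by omega))) (h₂.of_agreeBelow h₄ le_rfl) ?_ ?_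
    · rintro _ ⟨s, hs, rfl⟩
      simpa only [Function.update_of_ne (hne _), Function.update_of_ne (Nat.lt_succ_self _).ne]
        using h₃ s hs
    · rintro _ ⟨s, -, rfl⟩
      simp only [Function.update_self, Function.update_of_ne (hne _)]
  cases c
  · refine (holds_quantFun (p := fun F => ∃ G, p F G) hX fun F D' X' h₁ h₂ h₃ => ?_).trans
      (by simp)
    simp only [Bool.false_eq_true, if_false, holds_exDep hne, key F _ _ X' h₁ h₂ h₃]
  · refine (holds_quantFun (p := fun F => ∀ G, p F G) hX fun F D' X' h₁ h₂ h₃ => ?_).trans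
      (by simp)
    simp only [if_true, holds_allDep hne, key F _ _ X' h₁ h₂ h₃]

end BIDFormula

/-- First-order variables of BID-logic that represent the variables of second-order logic: a
`q`-ary function variable with code `b` is represented by the argument variables
`b, …, b + q - 1` and the value `b + q`; a `q`-ary relation variable with code `b` by these
argument variables and the equation of `b + q` and `b + q + 1`. A relation variable without a
code stands for the empty relation. -/
structure VarCode where
  /-- codes of the first-order variables -/
  elem : ℕ → ℕ
  /-- codes of the function variables -/
  func : ℕ × ℕ → ℕ
  /-- codes of the relation variables -/
  rel : ℕ × ℕ → Option ℕ

namespace VarCode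

/-- Change the code of a first-order variable. -/
def setElem (ρ : VarCode) (x b : ℕ) : VarCode := { ρ with elem := Function.update ρ.elem x b }

/-- Change the code of a function variable. -/
def setFunc (ρ : VarCode) (q k b : ℕ) : VarCode :=
  { ρ with func := Function.update ρ.func (q, k) b }

/-- Change the code of a relation variable. -/
def setRel (ρ : VarCode) (q k : ℕ) (b : Option ℕ) : VarCode :=
  { ρ with rel := Function.update ρ.rel (q, k) b }

end VarCode

/-- The team `X` represents the valuation `A` on the first-order variables in `V`, the function
variables in `G` and the relation variables in `R`, by variables below `n`. -/
structure Represents {M : Type w} (ρ : VarCode) (n : ℕ) (V : Set ℕ) (G R : Set (ℕ × ℕ))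
    (A : SOValuation M) (X : Set (ℕ → M)) : Prop where
  nonempty : X.Nonempty
  elem_lt : ∀ x ∈ V, ρ.elem x < n
  elem_eq : ∀ x ∈ V, ∀ s ∈ X, s (ρ.elem x) = A.elem x
  func_lt : ∀ q k, (q, k) ∈ G → ρ.func (q, k) + q < n
  func_full : ∀ q k, (q, k) ∈ G → IsFull (ρ.func (q, k)) q X
  func_eq : ∀ q k, (q, k) ∈ G → ∀ s ∈ X,
    s (ρ.func (q, k) + q) = A.func q k fun i => s (ρ.func (q, k) + i)
  rel_none : ∀ q k, (q, k) ∈ R → ρ.rel (q, k) = none → ∀ z, ¬ A.pred q k z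
  rel_lt : ∀ q k, (q, k) ∈ R → ∀ b, ρ.rel (q, k) = some b → b + q + 1 < n
  rel_full : ∀ q k, (q, k) ∈ R → ∀ b, ρ.rel (q, k) = some b → IsFull b q X
  rel_iff : ∀ q k, (q, k) ∈ R → ∀ b, ρ.rel (q, k) = some b → ∀ s ∈ X,
    ((A.pred q k fun i => s (b + i)) ↔ s (b + q) = s (b + q + 1))

namespace Represents

variable {M : Type w} {ρ : VarCode} {n : ℕ} {V : Set ℕ} {G R : Set (ℕ × ℕ)}
  {A : SOValuation M} {X : Set (ℕ → M)}

theorem mono (h : Represents ρ n V G R A X) {V' : Set ℕ} {G' R' : Set (ℕ × ℕ)} (hV : V' ⊆ V)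
    (hG : G' ⊆ G) (hR : R' ⊆ R) : Represents ρ n V' G' R' A X where
  nonempty := h.nonempty
  elem_lt x hx := h.elem_lt x (hV hx)
  elem_eq x hx := h.elem_eq x (hV hx)
  func_lt q k hk := h.func_lt q k (hG hk)
  func_full q k hk := h.func_full q k (hG hk)
  func_eq q k hk := h.func_eq q k (hG hk)
  rel_none q k hk := h.rel_none q k (hR hk)
  rel_lt q k hk := h.rel_lt q k (hR hk)
  rel_full q k hk := h.rel_full q k (hR hk)
  rel_iff q k hk := h.rel_iff q k (hR hk)

/-- All codes lie below `n`, so auxiliary variables from `n` on can be changed freely. -/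
theorem agree (h : Represents ρ n V G R A X) {X' : Set (ℕ → M)} (hX : AgreeBelow n X X') {n' : ℕ}
    (hn : n ≤ n') : Represents ρ n' V G R A X' where
  nonempty := by
    obtain ⟨s, hs⟩ := h.nonempty
    obtain ⟨s', hs', -⟩ := hX.2 s hs
    exact ⟨s', hs'⟩
  elem_lt x hx := (h.elem_lt x hx).trans_le hn
  elem_eq x hx s' hs' := by
    obtain ⟨s, hs, e⟩ := hX.1 s' hs'
    rw [e _ (h.elem_lt x hx), h.elem_eq x hx s hs]
  func_lt q k hk := (h.func_lt q k hk).trans_le hn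
  func_full q k hk := (h.func_full q k hk).of_agreeBelow hX (h.func_lt q k hk).le
  func_eq q k hk s' hs' := by
    obtain ⟨s, hs, e⟩ := hX.1 s' hs'
    have hlt := h.func_lt q k hk
    have e' : ∀ i : Fin q, s' (ρ.func (q, k) + i) = s (ρ.func (q, k) + i) := fun i =>
      e _ (by omega)
    simp only [e', e _ hlt, h.func_eq q k hk s hs]
  rel_none q k hk := h.rel_none q k hk
  rel_lt q k hk b hb := (h.rel_lt q k hk b hb).trans_le hn
  rel_full q k hk b hb :=
    (h.rel_full q k hk b hb).of_agreeBelow hX (by have := h.rel_lt q k hk b hb; omega)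
  rel_iff q k hk b hb s' hs' := by
    obtain ⟨s, hs, e⟩ := hX.1 s' hs'
    have hlt := h.rel_lt q k hk b hb
    have e' : ∀ i : Fin q, s' (b + i) = s (b + i) := fun i => e _ (by omega)
    simp only [e', e _ hlt, e (b + q) (by omega), h.rel_iff q k hk b hb s hs]

/-- Nothing is required of the old code of `x`; `V \ {x}` is what the free variables of a quantified
formula provide. The same holds for `setFunc` and `setRel`. -/
theorem setElem {x b : ℕ} {a : M} (h : Represents ρ n (V \ {x}) G R A X) (hb : b < n)
    (ha : ∀ s ∈ X, s b = a) : Represents (ρ.setElem x b) n V G R (A.setElem x a) X where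
  nonempty := h.nonempty
  elem_lt y hy := by
    by_cases hyx : y = x
    · subst hyx; simpa [VarCode.setElem] using hb
    · simpa [VarCode.setElem, hyx] using h.elem_lt y ⟨hy, hyx⟩
  elem_eq y hy s hs := by
    by_cases hyx : y = x
    · subst hyx; simpa [VarCode.setElem, SOValuation.setElem] using ha s hs
    · simpa [VarCode.setElem, SOValuation.setElem, hyx] using h.elem_eq y ⟨hy, hyx⟩ s hs
  func_lt := h.func_lt
  func_full := h.func_full
  func_eq := h.func_eq
  rel_none := h.rel_none
  rel_lt := h.rel_lt
  rel_full := h.rel_full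
  rel_iff := h.rel_iff

theorem setFunc {q k b : ℕ} {F : (Fin q → M) → M} (h : Represents ρ n V (G \ {(q, k)}) R A X)
    (hb : b + q < n) (hX : IsFull b q X) (hF : ∀ s ∈ X, s (b + q) = F fun i => s (b + i)) :
    Represents (ρ.setFunc q k b) n V G R (A.setFunc q k F) X where
  nonempty := h.nonempty
  elem_lt := h.elem_lt
  elem_eq := h.elem_eq
  func_lt q' k' hk := by
    by_cases e : (q', k') = (q, k)
    · obtain ⟨rfl, rfl⟩ := Prod.mk.inj e
      simpa [VarCode.setFunc] using hb
    · simpa [VarCode.setFunc, Function.update_of_ne e] using h.func_lt q' k' ⟨hk, e⟩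
  func_full q' k' hk := by
    by_cases e : (q', k') = (q, k)
    · obtain ⟨rfl, rfl⟩ := Prod.mk.inj e
      simpa [VarCode.setFunc] using hX
    · simpa [VarCode.setFunc, Function.update_of_ne e] using h.func_full q' k' ⟨hk, e⟩
  func_eq q' k' hk := by
    by_cases e : (q', k') = (q, k)
    · obtain ⟨rfl, rfl⟩ := Prod.mk.inj e
      rw [A.setFunc_func_self]
      simpa [VarCode.setFunc] using hF
    · rw [A.setFunc_func_of_ne q k F e]
      simpa [VarCode.setFunc, Function.update_of_ne e] using h.func_eq q' k' ⟨hk, e⟩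
  rel_none := h.rel_none
  rel_lt := h.rel_lt
  rel_full := h.rel_full
  rel_iff := h.rel_iff

theorem setRel {q k : ℕ} {b : Option ℕ} {P : (Fin q → M) → Prop}
    (h : Represents ρ n V G (R \ {(q, k)}) A X) (hnone : b = none → ∀ z, ¬ P z)
    (hb : ∀ c, b = some c → c + q + 1 < n) (hX : ∀ c, b = some c → IsFull c q X)
    (hP : ∀ c, b = some c → ∀ s ∈ X, ((P fun i => s (c + i)) ↔ s (c + q) = s (c + q + 1))) :
    Represents (ρ.setRel q k b) n V G R (A.setPred q k P) X where
  nonempty := h.nonempty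
  elem_lt := h.elem_lt
  elem_eq := h.elem_eq
  func_lt := h.func_lt
  func_full := h.func_full
  func_eq := h.func_eq
  rel_none q' k' hk := by
    by_cases e : (q', k') = (q, k)
    · obtain ⟨rfl, rfl⟩ := Prod.mk.inj e
      rw [A.setPred_pred_self]
      simpa [VarCode.setRel] using hnone
    · rw [A.setPred_pred_of_ne q k P e]
      simpa [VarCode.setRel, Function.update_of_ne e] using h.rel_none q' k' ⟨hk, e⟩
  rel_lt q' k' hk := by
    by_cases e : (q', k') = (q, k)
    · obtain ⟨rfl, rfl⟩ := Prod.mk.inj e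
      simpa [VarCode.setRel] using hb
    · simpa [VarCode.setRel, Function.update_of_ne e] using h.rel_lt q' k' ⟨hk, e⟩
  rel_full q' k' hk := by
    by_cases e : (q', k') = (q, k)
    · obtain ⟨rfl, rfl⟩ := Prod.mk.inj e
      simpa [VarCode.setRel] using hX
    · simpa [VarCode.setRel, Function.update_of_ne e] using h.rel_full q' k' ⟨hk, e⟩
  rel_iff q' k' hk := by
    by_cases e : (q', k') = (q, k)
    · obtain ⟨rfl, rfl⟩ := Prod.mk.inj e
      rw [A.setPred_pred_self]
      simpa [VarCode.setRel] using hP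
    · rw [A.setPred_pred_of_ne q k P e]
      simpa [VarCode.setRel, Function.update_of_ne e] using h.rel_iff q' k' ⟨hk, e⟩

end Represents

variable {L : FirstOrder.Language.{u, v}}

/-- The statement that the variable `r` has the value of a given term; variables from `n` on are
used as auxiliary variables. -/
def SOTerm.toBID (ρ : VarCode) : SOTerm L → (n r : ℕ) → BIDFormula L
  | .var x, _, r => .eq (.var r) (.var (ρ.elem x))
  | .fn (n := m) f ts, n, r =>
    .withArgs n (fun i => (ts i).toBID ρ (n + m) (n + i))
      (.eq (.var r) (.func f fun i => .var (n + i)))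
  | .app (q := q) k ts, n, r =>
    .withArgs n (fun i => (ts i).toBID ρ (n + q) (n + i))
      (.atArgs (ρ.func (q, k)) q n (.eq (.var r) (.var (ρ.func (q, k) + q))))

/-- The translation of a second-order formula (for `c = true`) or of its negation (for
`c = false`); variables from `n` on are used as auxiliary variables. -/
def SOFormula.toBID : SOFormula L → VarCode → (n : ℕ) → (c : Bool) → BIDFormula L
  | .eq t₁ t₂, ρ, n, c =>
    .withArgs n (fun i : Fin 2 => (![t₁, t₂] i).toBID ρ (n + 2) (n + i))
      (if c then .eq (.var n) (.var (n + 1)) else .neq (.var n) (.var (n + 1)))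
  | .rel (n := m) R ts, ρ, n, c =>
    .withArgs n (fun i => (ts i).toBID ρ (n + m) (n + i))
      (if c then .rel R fun i => .var (n + i) else .nrel R fun i => .var (n + i))
  | .relVar (q := q) k ts, ρ, n, c =>
    match ρ.rel (q, k) with
    | none => if c then .bot else .imp .bot .bot
    | some b =>
      .withArgs n (fun i => (ts i).toBID ρ (n + q) (n + i))
        (.atArgs b q n
          (if c then .eq (.var (b + q)) (.var (b + q + 1))
            else .neq (.var (b + q)) (.var (b + q + 1))))
  | .not φ, ρ, n, c => φ.toBID ρ n (!c)
  | .and φ χ, ρ, n, c =>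
    if c then .and (φ.toBID ρ n c) (χ.toBID ρ n c) else .ior (φ.toBID ρ n c) (χ.toBID ρ n c)
  | .or φ χ, ρ, n, c =>
    if c then .ior (φ.toBID ρ n c) (χ.toBID ρ n c) else .and (φ.toBID ρ n c) (χ.toBID ρ n c)
  | .all x φ, ρ, n, c => .quantFun c n 0 (φ.toBID (ρ.setElem x n) (n + 1) c)
  | .ex x φ, ρ, n, c => .quantFun (!c) n 0 (φ.toBID (ρ.setElem x n) (n + 1) c)
  | .allFun q k φ, ρ, n, c => .quantFun c n q (φ.toBID (ρ.setFunc q k n) (n + q + 1) c)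
  | .exFun q k φ, ρ, n, c => .quantFun (!c) n q (φ.toBID (ρ.setFunc q k n) (n + q + 1) c)
  | .allRel q k φ, ρ, n, c =>
    if c then
      .and (φ.toBID (ρ.setRel q k none) n c)
        (.quantFun₂ c n q (φ.toBID (ρ.setRel q k (some n)) (n + q + 2) c))
    else
      .ior (φ.toBID (ρ.setRel q k none) n c)
        (.quantFun₂ c n q (φ.toBID (ρ.setRel q k (some n)) (n + q + 2) c))
  | .exRel q k φ, ρ, n, c =>
    if c then
      .ior (φ.toBID (ρ.setRel q k none) n c)
        (.quantFun₂ (!c) n q (φ.toBID (ρ.setRel q k (some n)) (n + q + 2) c))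
    else
      .and (φ.toBID (ρ.setRel q k none) n c)
        (.quantFun₂ (!c) n q (φ.toBID (ρ.setRel q k (some n)) (n + q + 2) c))

/-! ### Correctness of the translation -/

section Correctness

variable {M : Type w} [L.Structure M] [Nonempty M]

theorem SOTerm.funVars_arg_subset_fn {m : ℕ} (f : L.Functions m) (ts : Fin m → SOTerm L)
    (i : Fin m) : (ts i).funVars ⊆ (SOTerm.fn f ts).funVars := by
  rintro g ⟨ts', h⟩
  exact ⟨ts', Set.mem_iUnion.2 ⟨i, h⟩⟩

theorem SOTerm.funVars_arg_subset_app {q : ℕ} (k : ℕ) (ts : Fin q → SOTerm L)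
    (i : Fin q) : (ts i).funVars ⊆ (SOTerm.app k ts).funVars := by
  rintro g ⟨ts', h⟩
  exact ⟨ts', Or.inr (Set.mem_iUnion.2 ⟨i, h⟩)⟩

theorem SOTerm.mem_funVars_app {q : ℕ} (k : ℕ) (ts : Fin q → SOTerm L) :
    (q, k) ∈ (SOTerm.app k ts).funVars := ⟨ts, Or.inl rfl⟩

/-- The arguments are evaluated into fresh constants, to which `holds_withArgs` applies by
induction. -/
theorem SOTerm.holds_toBID {ρ : VarCode} {R : Set (ℕ × ℕ)} {A : SOValuation M} {a : M}
    (t : SOTerm L) : ∀ {n r : ℕ} {D : Finset ℕ} {X : Set (ℕ → M)},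
    Represents ρ n t.vars t.funVars R A X → r < n → (∀ s ∈ X, s r = a) →
      ((t.toBID ρ n r).Holds D X ↔ a = t.realize A) := by
  induction t generalizing a with
  | var x =>
    intro n r D X h hr ha
    obtain ⟨s, hs⟩ := h.nonempty
    have e := h.elem_eq x rfl
    simp only [toBID, BIDFormula.Holds, FirstOrder.Language.Term.realize_var, realize]
    exact ⟨fun h' => by rw [← ha s hs, ← e s hs, h' s hs],
      fun h' s hs => by rw [ha s hs, e s hs, h']⟩
  | @fn m f ts ih =>
    intro n r D X h hr ha
    refine BIDFormula.holds_withArgs (z := fun i => (ts i).realize A) ?_ ?_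
    · intro D' X' hX i c hc
      exact ih i ((h.mono (Set.subset_iUnion _ i) (funVars_arg_subset_fn f ts i)
        subset_rfl).agree hX (by omega)) (by omega) hc
    · intro D' X' hX hz
      obtain ⟨s, hs⟩ := (h.agree hX le_rfl).nonempty
      have hr' : ∀ s ∈ X', s r = a := fun s' hs' => by
        obtain ⟨s, hs, e⟩ := hX.1 s' hs'
        rw [e r hr, ha s hs]
      simp only [BIDFormula.Holds, FirstOrder.Language.Term.realize_var,
        FirstOrder.Language.Term.realize_func, realize]
      constructor
      · intro h'
        rw [← hr' s hs, h' s hs]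
        simp only [hz s hs]
      · intro h' s hs
        simp only [hz s hs, hr' s hs, h']
  | @app q k ts ih =>
    intro n r D X h hr ha
    refine BIDFormula.holds_withArgs (z := fun i => (ts i).realize A) ?_ ?_
    · intro D' X' hX i c hc
      exact ih i ((h.mono (Set.subset_iUnion _ i) (funVars_arg_subset_app k ts i)
        subset_rfl).agree hX (by omega)) (by omega) hc
    · intro D' X' hX hz
      have h' := h.agree hX le_rfl
      have hk := mem_funVars_app k ts
      have hr' : ∀ s ∈ X', s r = a := fun s' hs' => by
        obtain ⟨s, hs, e⟩ := hX.1 s' hs'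
        rw [e r hr, ha s hs]
      rw [BIDFormula.holds_atArgs (C := fun s => s r = s (ρ.func (q, k) + q)) fun Y => by
        simp only [BIDFormula.Holds, FirstOrder.Language.Term.realize_var]]
      simp only [realize]
      constructor
      · intro h''
        -- Fullness supplies an assignment that stores the function at the required arguments, so
        -- the restriction by `atArgs` is not vacuous.
        obtain ⟨s, hs, e⟩ := h'.func_full q k hk fun i => (ts i).realize A
        rw [← hr' s hs, h'' s hs fun i => (e i).trans (hz s hs i).symm, h'.func_eq q k hk s hs]
        simp only [e]
      · intro h'' s hs e
        rw [hr' s hs, h'.func_eq q k hk s hs, h'']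
        simp only [e, hz s hs]

/-- If `M` has distinct elements `a` and `b`, then `P` is the equalizer of the constant `a` and the
function that is `a` on `P` and `b` elsewhere. On a one-point model only the full relation is an
equalizer, so the empty one must be added. -/
theorem forall_pred_iff {q : ℕ} {p : ((Fin q → M) → Prop) → Prop} :
    (∀ P, p P) ↔ p (fun _ => False) ∧ ∀ F G : (Fin q → M) → M, p fun z => F z = G z := by
  refine ⟨fun h => ⟨h _, fun F G => h _⟩, fun ⟨h₀, h⟩ P => ?_⟩
  rcases subsingleton_or_nontrivial M with hM | hM
  · by_cases hP : ∃ z, P z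
    · obtain ⟨z, hz⟩ := hP
      convert h (fun _ => Classical.arbitrary M) (fun _ => Classical.arbitrary M) with z'
      simpa [Subsingleton.elim z' z] using hz
    · push Not at hP
      convert h₀ with z
      simpa using hP z
  · classical
    obtain ⟨a, b, hab⟩ := exists_pair_ne M
    convert h (fun _ => a) (fun z => if P z then a else b) with z
    split_ifs with hz <;> simp [hz, hab]

theorem exists_pred_iff {q : ℕ} {p : ((Fin q → M) → Prop) → Prop} :
    (∃ P, p P) ↔ p (fun _ => False) ∨ ∃ F G : (Fin q → M) → M, p fun z => F z = G z := by
  rw [← not_iff_not]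
  push Not
  exact forall_pred_iff

/-- The truth value of `φ`, negated for `c = false`. -/
def SOFormula.RealizeBool (φ : SOFormula L) (c : Bool) (A : SOValuation M) : Prop :=
  if c then φ.Realize A else ¬ φ.Realize A

/-- Truth depends only on the represented valuation, not on the representing team. Therefore `⊔`
acts as classical disjunction, and the induction runs for both values of `c` at once. -/
theorem SOFormula.holds_toBID (φ : SOFormula L) : ∀ {ρ : VarCode} {A : SOValuation M} {n : ℕ}
    {c : Bool} {D : Finset ℕ} {X : Set (ℕ → M)},
    Represents ρ n φ.freeVars φ.freeFunVars φ.freeRelVars A X →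
      ((φ.toBID ρ n c).Holds D X ↔ φ.RealizeBool c A) := by
  induction φ with
  | eq t₁ t₂ =>
    intro ρ A n c D X h
    refine BIDFormula.holds_withArgs (z := fun i => (![t₁, t₂] i).realize A) ?_ ?_
    · intro D' X' hX i a ha
      refine SOTerm.holds_toBID (R := ∅) _ ((h.mono ?_ ?_ (Set.empty_subset _)).agree hX
        (by omega)) (by omega) ha
      · fin_cases i
        exacts [Set.subset_union_left, Set.subset_union_right]
      · fin_cases i
        exacts [Set.subset_union_left, Set.subset_union_right]
    · intro D' X' hX hz
      obtain ⟨s, hs⟩ := (h.agree hX le_rfl).nonempty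
      have h₀ : ∀ s ∈ X', s n = t₁.realize A := fun s hs => hz s hs 0
      have h₁ : ∀ s ∈ X', s (n + 1) = t₂.realize A := fun s hs => hz s hs 1
      cases c
      · simp only [RealizeBool, Realize, Bool.false_eq_true, if_false, BIDFormula.Holds,
          FirstOrder.Language.Term.realize_var]
        exact ⟨fun h => by simpa [h₀ s hs, h₁ s hs] using h s hs,
          fun h s hs => by simpa [h₀ s hs, h₁ s hs] using h⟩
      · simp only [RealizeBool, Realize, if_true, BIDFormula.Holds,
          FirstOrder.Language.Term.realize_var]
        exact ⟨fun h => by simpa [h₀ s hs, h₁ s hs] using h s hs,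
          fun h s hs => by simpa [h₀ s hs, h₁ s hs] using h⟩
  | @rel m S ts =>
    intro ρ A n c D X h
    refine BIDFormula.holds_withArgs (z := fun i => (ts i).realize A) ?_ ?_
    · intro D' X' hX i a ha
      exact SOTerm.holds_toBID (R := ∅) _ ((h.mono (Set.subset_iUnion (fun i => (ts i).vars) i)
        (Set.subset_iUnion (fun i => (ts i).funVars) i) (Set.empty_subset _)).agree hX
        (by omega)) (by omega) ha
    · intro D' X' hX hz
      obtain ⟨s, hs⟩ := (h.agree hX le_rfl).nonempty
      cases c
      · simp only [RealizeBool, Realize, Bool.false_eq_true, if_false, BIDFormula.Holds,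
          FirstOrder.Language.Term.realize_var]
        exact ⟨fun h => by simpa only [hz s hs] using h s hs,
          fun h s hs => by simpa only [hz s hs] using h⟩
      · simp only [RealizeBool, Realize, if_true, BIDFormula.Holds,
          FirstOrder.Language.Term.realize_var]
        exact ⟨fun h => by simpa only [hz s hs] using h s hs,
          fun h s hs => by simpa only [hz s hs] using h⟩
  | @relVar q k ts =>
    intro ρ A n c D X h
    have hk : (q, k) ∈ (SOFormula.relVar k ts).freeRelVars := rfl
    cases hb : ρ.rel (q, k) with
    | none =>
      have := h.rel_none q k hk hb
      -- Nonemptiness matters here, as `⊥` holds in the empty team.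
      have hne := h.nonempty.ne_empty
      cases c <;> simp [toBID, hb, RealizeBool, Realize, BIDFormula.Holds, this, hne]
    | some b =>
      simp only [toBID, hb]
      refine BIDFormula.holds_withArgs (z := fun i => (ts i).realize A) ?_ ?_
      · intro D' X' hX i a ha
        refine SOTerm.holds_toBID (R := ∅) _ ((h.mono (Set.subset_iUnion (fun i => (ts i).vars) i)
          (Set.subset_iUnion (fun i => (ts i).funVars) i) (Set.empty_subset _)).agree hX
          (by omega)) (by omega) ha
      · intro D' X' hX hz
        have h' := h.agree hX le_rfl
        obtain ⟨s, hs, e⟩ := h'.rel_full q k hk b hb fun i => (ts i).realize A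
        have hp := h'.rel_iff q k hk b hb
        cases c
        · rw [BIDFormula.holds_atArgs (C := fun s => s (b + q) ≠ s (b + q + 1)) fun Y => by
            simp only [BIDFormula.Holds, FirstOrder.Language.Term.realize_var, if_false,
              Bool.false_eq_true]]
          simp only [RealizeBool, Realize, Bool.false_eq_true, if_false]
          constructor
          · intro h''
            have := h'' s hs fun i => (e i).trans (hz s hs i).symm
            rw [Ne, ← hp s hs] at this
            simpa only [e] using this
          · intro h'' s hs e
            rw [Ne, ← hp s hs]
            simpa only [e, hz s hs] using h''
        · rw [BIDFormula.holds_atArgs (C := fun s => s (b + q) = s (b + q + 1)) fun Y => by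
            simp only [BIDFormula.Holds, FirstOrder.Language.Term.realize_var, if_true]]
          simp only [RealizeBool, Realize, if_true]
          constructor
          · intro h''
            have := h'' s hs fun i => (e i).trans (hz s hs i).symm
            rw [← hp s hs] at this
            simpa only [e] using this
          · intro h'' s hs e
            rw [← hp s hs]
            simpa only [e, hz s hs] using h''
  | not φ ih =>
    intro ρ A n c D X h
    refine (ih h).trans ?_
    cases c <;> simp [RealizeBool, Realize]
  | and φ χ ihφ ihχ =>
    intro ρ A n c D X h
    have h₁ := fun c => ihφ (c := c) (D := D)
      (h.mono Set.subset_union_left Set.subset_union_left Set.subset_union_left)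
    have h₂ := fun c => ihχ (c := c) (D := D)
      (h.mono Set.subset_union_right Set.subset_union_right Set.subset_union_right)
    cases c <;> simp [toBID, BIDFormula.Holds, h₁, h₂, RealizeBool, Realize, imp_iff_not_or]
  | or φ χ ihφ ihχ =>
    intro ρ A n c D X h
    have h₁ := fun c => ihφ (c := c) (D := D)
      (h.mono Set.subset_union_left Set.subset_union_left Set.subset_union_left)
    have h₂ := fun c => ihχ (c := c) (D := D)
      (h.mono Set.subset_union_right Set.subset_union_right Set.subset_union_right)
    cases c <;> simp [toBID, BIDFormula.Holds, h₁, h₂, RealizeBool, Realize]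
  | all x φ ih =>
    intro ρ A n c D X h
    -- An element is a function of no arguments, so a first-order quantifier is a function
    -- quantifier of arity 0.
    refine (BIDFormula.holds_quantFun
      (p := fun F => φ.RealizeBool c (A.setElem x (F Fin.elim0))) h.nonempty ?_).trans ?_
    · intro F D' X' hX _ hF
      exact ih ((h.agree hX n.le_succ).setElem n.lt_succ_self fun s hs =>
        (hF s hs).trans (congrArg F (Subsingleton.elim _ _)))
    · cases c
      · simp only [RealizeBool, Realize, Bool.false_eq_true, if_false, not_forall]
        exact ⟨fun ⟨F, h⟩ => ⟨_, h⟩, fun ⟨a, h⟩ => ⟨fun _ => a, h⟩⟩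
      · simp only [RealizeBool, Realize, if_true]
        exact ⟨fun h a => h fun _ => a, fun h F => h _⟩
  | ex x φ ih =>
    intro ρ A n c D X h
    refine (BIDFormula.holds_quantFun
      (p := fun F => φ.RealizeBool c (A.setElem x (F Fin.elim0))) h.nonempty ?_).trans ?_
    · intro F D' X' hX _ hF
      exact ih ((h.agree hX n.le_succ).setElem n.lt_succ_self fun s hs =>
        (hF s hs).trans (congrArg F (Subsingleton.elim _ _)))
    · cases c
      · simp only [RealizeBool, Realize, Bool.false_eq_true, if_false, not_exists, Bool.not_false,
          if_true]
        exact ⟨fun h a => h fun _ => a, fun h F => h _⟩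
      · simp only [RealizeBool, Realize, if_true, Bool.not_true, Bool.false_eq_true, if_false]
        exact ⟨fun ⟨F, h⟩ => ⟨_, h⟩, fun ⟨a, h⟩ => ⟨fun _ => a, h⟩⟩
  | allFun q k φ ih =>
    intro ρ A n c D X h
    refine (BIDFormula.holds_quantFun
      (p := fun F => φ.RealizeBool c (A.setFunc q k F)) h.nonempty ?_).trans ?_
    · intro F D' X' hX hfull hF
      exact ih ((h.agree hX (by omega)).setFunc (by omega) hfull hF)
    · cases c <;> simp [RealizeBool, Realize]
  | exFun q k φ ih =>
    intro ρ A n c D X h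
    refine (BIDFormula.holds_quantFun
      (p := fun F => φ.RealizeBool c (A.setFunc q k F)) h.nonempty ?_).trans ?_
    · intro F D' X' hX hfull hF
      exact ih ((h.agree hX (by omega)).setFunc (by omega) hfull hF)
    · cases c <;> simp [RealizeBool, Realize]
  | allRel q k φ ih =>
    intro ρ A n c D X h
    -- `h₁` covers the empty relation, `h₂` the equalizers; `forall_pred_iff` and its dual put them
    -- together.
    have h₁ : (φ.toBID (ρ.setRel q k none) n c).Holds D X ↔
        φ.RealizeBool c (A.setPred q k fun _ => False) :=
      ih (h.setRel (by simp) (by simp) (by simp) (by simp))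
    have h₂ : ∀ c', (BIDFormula.quantFun₂ c' n q
        (φ.toBID (ρ.setRel q k (some n)) (n + q + 2) c)).Holds D X ↔ _ := fun c' =>
      BIDFormula.holds_quantFun₂
        (p := fun F G => φ.RealizeBool c (A.setPred q k fun z => F z = G z)) h.nonempty
        fun F G D' X' hX hfull hF hG => ih <| (h.agree hX (by omega)).setRel (by simp)
          (by simp) (by simpa using hfull) (by
            rintro _ ⟨rfl⟩ s hs
            rw [hF s hs, hG s hs])
    cases c
    · simp only [toBID, BIDFormula.Holds, h₁, h₂, RealizeBool, Realize, Bool.false_eq_true,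
        if_false, not_forall, exists_pred_iff]
    · simp only [toBID, BIDFormula.Holds, h₁, h₂, RealizeBool, Realize, if_true]
      exact (forall_pred_iff (p := fun P => φ.Realize (A.setPred q k P))).symm
  | exRel q k φ ih =>
    intro ρ A n c D X h
    have h₁ : (φ.toBID (ρ.setRel q k none) n c).Holds D X ↔
        φ.RealizeBool c (A.setPred q k fun _ => False) :=
      ih (h.setRel (by simp) (by simp) (by simp) (by simp))
    have h₂ : ∀ c', (BIDFormula.quantFun₂ c' n q
        (φ.toBID (ρ.setRel q k (some n)) (n + q + 2) c)).Holds D X ↔ _ := fun c' =>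
      BIDFormula.holds_quantFun₂
        (p := fun F G => φ.RealizeBool c (A.setPred q k fun z => F z = G z)) h.nonempty
        fun F G D' X' hX hfull hF hG => ih <| (h.agree hX (by omega)).setRel (by simp)
          (by simp) (by simpa using hfull) (by
            rintro _ ⟨rfl⟩ s hs
            rw [hF s hs, hG s hs])
    cases c
    · simp only [toBID, BIDFormula.Holds, h₁, h₂, RealizeBool, Realize, Bool.false_eq_true,
        if_false, not_exists, Bool.not_false, if_true]
      exact (forall_pred_iff (p := fun P => ¬ φ.Realize (A.setPred q k P))).symm
    · simp only [toBID, BIDFormula.Holds, h₁, h₂, RealizeBool, Realize, if_true, Bool.not_true,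
        Bool.false_eq_true, if_false, exists_pred_iff]

end Correctness

/-- Every second-order sentence is expressible in BID-logic. -/
theorem SOFormula.IsSentence.exists_BIDFormula {φ : SOFormula L} (hφ : φ.IsSentence) :
    ∃ φ' : BIDFormula L, φ'.IsSentence ∧
      ∀ (M : Type w) [L.Structure M] [Nonempty M], φ.TrueIn M ↔ φ'.TrueIn M := by
  -- A sentence has no free variables, so the initial codes are arbitrary and every nonempty team
  -- represents every valuation. Closing `χ` universally is thus harmless and makes it a sentence
  -- without computing its free variables.
  let χ := φ.toBID ⟨fun _ => 0, fun _ => 0, fun _ => none⟩ 0 true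
  refine ⟨.alls χ.freeVars_finite.toFinset.toList χ, ?_, fun M _ _ => ?_⟩
  · simp [BIDFormula.IsSentence, BIDFormula.freeVars_alls]
  · rw [BIDFormula.trueIn_iff, BIDFormula.holds_alls]
    have key : ∀ (A : SOValuation M) D (X : Set (ℕ → M)), X.Nonempty →
        (χ.Holds D X ↔ φ.Realize A) := by
      intro A D X hX
      refine SOFormula.holds_toBID φ (c := true) ?_
      rw [hφ.1, hφ.2.1, hφ.2.2]
      constructor <;> simp [hX]
    let s : ℕ → M := fun _ => Classical.arbitrary M
    have hX : {s' | ∃ t ∈ ({s} : Set (ℕ → M)), ∃ a,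
        s' = override χ.freeVars_finite.toFinset.toList a t}.Nonempty :=
      ⟨override _ s s, s, rfl, s, rfl⟩
    exact ⟨fun h => (key ⟨s, fun _ _ _ => s 0, fun _ _ _ => True⟩ _ _ hX).2 (h _),
      fun h A => (key A _ _ hX).1 h⟩

/-! ## Sentences in normal form -/

/-- Change the values of the `q`-ary function variables with indices in `ks` to those of `F`. -/
def SOValuation.overrideFunc {M : Type w} (A : SOValuation M) (q : ℕ) (ks : List ℕ)
    (F : ℕ → (Fin q → M) → M) : SOValuation M :=
  { A with func := Function.update A.func q (override ks F (A.func q)) }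

namespace SOFormula

theorem realize_alls {M : Type w} [L.Structure M] [Nonempty M] (xs : List ℕ) (φ : SOFormula L)
    (A : SOValuation M) :
    (alls xs φ).Realize A ↔ ∀ a, φ.Realize { A with elem := override xs a A.elem } := by
  induction xs generalizing A with
  | nil => simp [alls]
  | cons x xs ih =>
    change (∀ c, (alls xs φ).Realize (A.setElem x c)) ↔ _
    simp only [ih, SOValuation.setElem]
    constructor
    · intro h a
      rw [override_cons]
      exact h (a x) a
    · intro h c a
      rw [override_update]
      exact h _

variable {M : Type w} (A : SOValuation M) (q k : ℕ) (ks : List ℕ)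

theorem _root_.TeamLogic.SOValuation.overrideFunc_nil (F : ℕ → (Fin q → M) → M) : A.overrideFunc q [] F = A := by
  simp [SOValuation.overrideFunc]

theorem _root_.TeamLogic.SOValuation.overrideFunc_cons (F : ℕ → (Fin q → M) → M) :
    A.overrideFunc q (k :: ks) F = (A.setFunc q k (F k)).overrideFunc q ks F := by
  simp [SOValuation.overrideFunc, SOValuation.setFunc, override_cons]

theorem _root_.TeamLogic.SOValuation.overrideFunc_setFunc (F : ℕ → (Fin q → M) → M) (F₀ : (Fin q → M) → M) :
    (A.setFunc q k F₀).overrideFunc q ks F =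
      A.overrideFunc q (k :: ks) fun y => if y ∈ ks then F y else F₀ := by
  simp [SOValuation.overrideFunc, SOValuation.setFunc, override_update]

theorem realize_allFuns [L.Structure M] [Nonempty M] (φ : SOFormula L) :
    (allFuns q ks φ).Realize A ↔ ∀ F, φ.Realize (A.overrideFunc q ks F) := by
  induction ks generalizing A with
  | nil => simp [allFuns, SOValuation.overrideFunc_nil]
  | cons k ks ih =>
    change (∀ F₀, (allFuns q ks φ).Realize (A.setFunc q k F₀)) ↔ _
    simp only [ih]
    constructor
    · intro h F
      rw [A.overrideFunc_cons]
      exact h _ _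
    · intro h F₀ F
      rw [A.overrideFunc_setFunc]
      exact h _

theorem realize_exFuns [L.Structure M] [Nonempty M] (φ : SOFormula L) :
    (exFuns q ks φ).Realize A ↔ ∃ F, φ.Realize (A.overrideFunc q ks F) := by
  induction ks generalizing A with
  | nil => simp only [exFuns, SOValuation.overrideFunc_nil, List.foldr_nil, exists_const]
  | cons k ks ih =>
    change (∃ F₀, (exFuns q ks φ).Realize (A.setFunc q k F₀)) ↔ _
    simp only [ih]
    constructor
    · rintro ⟨F₀, F, h⟩
      exact ⟨_, A.overrideFunc_setFunc q k ks F F₀ ▸ h⟩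
    · rintro ⟨F, h⟩
      exact ⟨F k, F, A.overrideFunc_cons q k ks F ▸ h⟩

/-! ### Free variables of prefixed formulas -/

theorem freeVars_alls (xs : List ℕ) (φ : SOFormula L) :
    φ.freeVars ⊆ (alls xs φ).freeVars ∪ {x | x ∈ xs} := by
  induction xs with
  | nil => exact fun x hx => Or.inl hx
  | cons x xs ih =>
    intro z hz
    by_cases h : z ∈ x :: xs
    · exact Or.inr h
    · rw [List.mem_cons, not_or] at h
      exact Or.inl ⟨(ih hz).resolve_right h.2, h.1⟩

theorem freeFunVars_alls (xs : List ℕ) (φ : SOFormula L) :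
    (alls xs φ).freeFunVars = φ.freeFunVars := by
  induction xs with
  | nil => rfl
  | cons x xs ih => exact ih

theorem freeRelVars_alls (xs : List ℕ) (φ : SOFormula L) :
    (alls xs φ).freeRelVars = φ.freeRelVars := by
  induction xs with
  | nil => rfl
  | cons x xs ih => exact ih

theorem freeVars_funPrefix {p : ℕ} (f : ℕ → Fin p → ℕ) (χ : SOFormula L) (r i : ℕ) :
    (funPrefix q f χ r i).freeVars = χ.freeVars := by
  have h₁ : ∀ (φ : SOFormula L) ks, (allFuns q ks φ).freeVars = φ.freeVars := fun φ ks => by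
    induction ks with
    | nil => rfl
    | cons k ks ih => exact ih
  have h₂ : ∀ (φ : SOFormula L) ks, (exFuns q ks φ).freeVars = φ.freeVars := fun φ ks => by
    induction ks with
    | nil => rfl
    | cons k ks ih => exact ih
  induction r generalizing i with
  | zero => rfl
  | succ r ih =>
    rw [funPrefix]
    split_ifs <;> simp only [h₁, h₂, ih]

theorem freeRelVars_funPrefix {p : ℕ} (f : ℕ → Fin p → ℕ) (χ : SOFormula L) (r i : ℕ) :
    (funPrefix q f χ r i).freeRelVars = χ.freeRelVars := by
  have h₁ : ∀ (φ : SOFormula L) ks, (allFuns q ks φ).freeRelVars = φ.freeRelVars := fun φ ks => by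
    induction ks with
    | nil => rfl
    | cons k ks ih => exact ih
  have h₂ : ∀ (φ : SOFormula L) ks, (exFuns q ks φ).freeRelVars = φ.freeRelVars := fun φ ks => by
    induction ks with
    | nil => rfl
    | cons k ks ih => exact ih
  induction r generalizing i with
  | zero => rfl
  | succ r ih =>
    rw [funPrefix]
    split_ifs <;> simp only [h₁, h₂, ih]

/-- For a closed prefixed formula the first alternative is void, so every free function variable of
`χ` belongs to some block. -/
theorem freeFunVars_funPrefix {p : ℕ} (f : ℕ → Fin p → ℕ) (χ : SOFormula L) {r i : ℕ}
    {g : ℕ × ℕ} (hg : g ∈ χ.freeFunVars) : g ∈ (funPrefix q f χ r i).freeFunVars ∨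
      ∃ i', i ≤ i' ∧ i' < i + r ∧ ∃ j, g = (q, f i' j) := by
  have h₁ : ∀ (φ : SOFormula L) ks, g ∈ φ.freeFunVars →
      g ∈ (allFuns q ks φ).freeFunVars ∨ ∃ k ∈ ks, g = (q, k) := fun φ ks h => by
    induction ks with
    | nil => exact Or.inl h
    | cons k ks ih =>
      by_cases hk : g = (q, k)
      · exact Or.inr ⟨k, List.mem_cons_self, hk⟩
      · exact ih.imp (fun h => ⟨h, hk⟩) fun ⟨k', h, e⟩ => ⟨k', List.mem_cons_of_mem _ h, e⟩
  have h₂ : ∀ (φ : SOFormula L) ks, g ∈ φ.freeFunVars →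
      g ∈ (exFuns q ks φ).freeFunVars ∨ ∃ k ∈ ks, g = (q, k) := fun φ ks h => by
    induction ks with
    | nil => exact Or.inl h
    | cons k ks ih =>
      by_cases hk : g = (q, k)
      · exact Or.inr ⟨k, List.mem_cons_self, hk⟩
      · exact ih.imp (fun h => ⟨h, hk⟩) fun ⟨k', h, e⟩ => ⟨k', List.mem_cons_of_mem _ h, e⟩
  induction r generalizing i with
  | zero => exact Or.inl hg
  | succ r ih =>
    rcases ih (i := i + 1) with h | ⟨i', hi, hi', j, e⟩
    · rw [funPrefix]
      split_ifs
      · refine (h₁ _ (List.ofFn (f i)) h).imp_right ?_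
        rintro ⟨k, hk, e⟩
        obtain ⟨j, rfl⟩ := List.mem_ofFn.1 hk
        exact ⟨i, le_rfl, by omega, j, e⟩
      · refine (h₂ _ (List.ofFn (f i)) h).imp_right ?_
        rintro ⟨k, hk, e⟩
        obtain ⟨j, rfl⟩ := List.mem_ofFn.1 hk
        exact ⟨i, le_rfl, by omega, j, e⟩
    · exact Or.inr ⟨i', by omega, by omega, j, e⟩

end SOFormula

/-! ### The quantifier-free part -/

section Replace

variable {M : Type w} [L.Structure M] {y : ℕ → ℕ}

theorem SOTerm.realize_replace {s : ℕ → M} {A : SOValuation M} (t : SOTerm L)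
    (hv : ∀ x ∈ t.vars, A.elem x = s x)
    (ha : ∀ q k ts, ⟨q, k, ts⟩ ∈ t.apps → s (y k) = A.func q k fun i => (ts i).realize A) :
    (t.replace y).realize s = t.realize A := by
  induction t with
  | var x => exact (hv x rfl).symm
  | fn f ts ih =>
    simp only [replace, FirstOrder.Language.Term.realize_func, realize]
    congr 1
    funext i
    exact ih i (fun x hx => hv x (Set.mem_iUnion.2 ⟨i, hx⟩))
      fun q k ts' h => ha q k ts' (Set.mem_iUnion.2 ⟨i, h⟩)
  | app k ts ih => exact ha _ _ _ (Or.inl rfl)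

/-- The replaced formula is flat. Each assignment determines its own valuation, and the hypotheses
pass to subteams, as split disjunction requires. -/
theorem SOFormula.holds_replace [Nonempty M] {A : (ℕ → M) → SOValuation M} {D : Finset ℕ}
    {ψ : SOFormula L} :
    ∀ {X : Set (ℕ → M)} {c : Bool}, ψ.IsQF → ψ.freeRelVars = ∅ →
    (∀ s ∈ X, ∀ x ∈ ψ.freeVars, (A s).elem x = s x) →
    (∀ s ∈ X, ∀ q k ts, ⟨q, k, ts⟩ ∈ ψ.apps →
      s (y k) = (A s).func q k fun i => (ts i).realize (A s)) →
    ((ψ.replace y c).Holds D X ↔ ∀ s ∈ X, ψ.RealizeBool c (A s)) := by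
  have union : ∀ {X : Set (ℕ → M)} {P Q : (ℕ → M) → Prop} {φ χ : BIDFormula L},
      (∀ Y, Y ⊆ X → (φ.Holds D Y ↔ ∀ s ∈ Y, P s)) → (∀ Y, Y ⊆ X → (χ.Holds D Y ↔ ∀ s ∈ Y, Q s)) →
      ((BIDFormula.split φ χ).Holds D X ↔ ∀ s ∈ X, P s ∨ Q s) := by
    intro X P Q φ χ hφ hχ
    constructor
    · rintro ⟨Y, Z, rfl, hY, hZ⟩ s (hs | hs)
      · exact Or.inl ((hφ Y Set.subset_union_left).1 hY s hs)
      · exact Or.inr ((hχ Z Set.subset_union_right).1 hZ s hs)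
    · intro h
      -- The team is split by which disjunct holds at each assignment; overlap is allowed.
      refine ⟨{s ∈ X | P s}, {s ∈ X | Q s}, ?_, (hφ _ (Set.sep_subset _ _)).2 fun s hs => hs.2,
        (hχ _ (Set.sep_subset _ _)).2 fun s hs => hs.2⟩
      ext s
      exact ⟨fun hs => (h s hs).imp (fun h => ⟨hs, h⟩) fun h => ⟨hs, h⟩,
        fun hs => hs.elim (fun h => h.1) fun h => h.1⟩
  induction ψ with
  | eq t₁ t₂ =>
    intro X c _ _ hv ha
    have h₁ : ∀ s ∈ X, (t₁.replace y).realize s = t₁.realize (A s) := fun s hs =>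
      t₁.realize_replace (fun x hx => hv s hs x (Or.inl hx))
        fun q k ts h => ha s hs q k ts (Or.inl h)
    have h₂ : ∀ s ∈ X, (t₂.replace y).realize s = t₂.realize (A s) := fun s hs =>
      t₂.realize_replace (fun x hx => hv s hs x (Or.inr hx))
        fun q k ts h => ha s hs q k ts (Or.inr h)
    cases c
    · exact forall₂_congr fun s hs => by simp [RealizeBool, Realize, h₁ s hs, h₂ s hs]
    · exact forall₂_congr fun s hs => by simp [RealizeBool, Realize, h₁ s hs, h₂ s hs]
  | rel R ts =>
    intro X c _ _ hv ha
    have h : ∀ s ∈ X, ∀ i, ((ts i).replace y).realize s = (ts i).realize (A s) := fun s hs i =>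
      (ts i).realize_replace (fun x hx => hv s hs x (Set.mem_iUnion.2 ⟨i, hx⟩))
        fun q k ts h => ha s hs q k ts (Set.mem_iUnion.2 ⟨i, h⟩)
    cases c
    · exact forall₂_congr fun s hs => by simp [RealizeBool, Realize, h s hs]
    · exact forall₂_congr fun s hs => by simp [RealizeBool, Realize, h s hs]
  | @relVar q k ts =>
    intro X c _ hR
    exact absurd hR (Set.singleton_nonempty (q, k)).ne_empty
  | not φ ih =>
    intro X c hqf hR hv ha
    refine (ih (c := !c) hqf hR hv ha).trans (forall₂_congr fun s _ => ?_)
    cases c <;> simp [RealizeBool, Realize]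
  | and φ χ ihφ ihχ =>
    intro X c hqf hR hv ha
    have hR := Set.union_empty_iff.1 hR
    have h₁ : ∀ Y, Y ⊆ X → _ := fun Y hY => ihφ (X := Y) (c := c) hqf.1 hR.1
      (fun s hs x hx => hv s (hY hs) x (Or.inl hx))
      fun s hs q k ts h => ha s (hY hs) q k ts (Or.inl h)
    have h₂ : ∀ Y, Y ⊆ X → _ := fun Y hY => ihχ (X := Y) (c := c) hqf.2 hR.2
      (fun s hs x hx => hv s (hY hs) x (Or.inr hx))
      fun s hs q k ts h => ha s (hY hs) q k ts (Or.inr h)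
    cases c
    · refine (union h₁ h₂).trans (forall₂_congr fun s _ => ?_)
      simp [RealizeBool, Realize, imp_iff_not_or]
    · refine (and_congr (h₁ X subset_rfl) (h₂ X subset_rfl)).trans ?_
      simp [RealizeBool, Realize, forall_and]
  | or φ χ ihφ ihχ =>
    intro X c hqf hR hv ha
    have hR := Set.union_empty_iff.1 hR
    have h₁ : ∀ Y, Y ⊆ X → _ := fun Y hY => ihφ (X := Y) (c := c) hqf.1 hR.1
      (fun s hs x hx => hv s (hY hs) x (Or.inl hx))
      fun s hs q k ts h => ha s (hY hs) q k ts (Or.inl h)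
    have h₂ : ∀ Y, Y ⊆ X → _ := fun Y hY => ihχ (X := Y) (c := c) hqf.2 hR.2
      (fun s hs x hx => hv s (hY hs) x (Or.inr hx))
      fun s hs q k ts h => ha s (hY hs) q k ts (Or.inr h)
    cases c
    · refine (and_congr (h₁ X subset_rfl) (h₂ X subset_rfl)).trans ?_
      simp [RealizeBool, Realize, forall_and]
    · refine (union h₁ h₂).trans (forall₂_congr fun s _ => ?_)
      simp [RealizeBool, Realize]
  | all x φ ih => exact fun h => h.elim
  | ex x φ ih => exact fun h => h.elim
  | allFun q k φ ih => exact fun h => h.elim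
  | exFun q k φ ih => exact fun h => h.elim
  | allRel q k φ ih => exact fun h => h.elim
  | exRel q k φ ih => exact fun h => h.elim

theorem SOTerm.freeVars_replace (t : SOTerm L) :
    ((t.replace y).varFinset : Set ℕ) ⊆ t.vars ∪ y '' {k | ∃ q, (q, k) ∈ t.funVars} := by
  induction t with
  | var x => simp [replace, vars]
  | fn f ts ih =>
    simp only [replace, FirstOrder.Language.Term.varFinset, Finset.coe_biUnion]
    refine Set.iUnion₂_subset fun i _ => (ih i).trans (Set.union_subset_union ?_ ?_)
    · exact Set.subset_iUnion (fun i => (ts i).vars) i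
    · rintro _ ⟨k, ⟨q, h⟩, rfl⟩
      exact ⟨k, ⟨q, funVars_arg_subset_fn f ts i h⟩, rfl⟩
  | @app q k ts ih =>
    simp only [replace, FirstOrder.Language.Term.varFinset, Finset.coe_singleton,
      Set.singleton_subset_iff]
    exact Or.inr ⟨k, ⟨q, mem_funVars_app k ts⟩, rfl⟩

theorem SOFormula.freeVars_replace {ψ : SOFormula L} (hψ : ψ.IsQF) {c : Bool} :
    (ψ.replace y c).freeVars ⊆ ψ.freeVars ∪ y '' {k | ∃ q, (q, k) ∈ ψ.freeFunVars} := by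
  have mono : ∀ {V V' : Set ℕ} {G G' : Set (ℕ × ℕ)}, V ⊆ V' → G ⊆ G' →
      V ∪ y '' {k | ∃ q, (q, k) ∈ G} ⊆ V' ∪ y '' {k | ∃ q, (q, k) ∈ G'} := fun hV hG =>
    Set.union_subset_union hV (Set.image_mono fun k ⟨q, h⟩ => ⟨q, hG h⟩)
  induction ψ generalizing c with
  | eq t₁ t₂ =>
    have := Set.union_subset
      (t₁.freeVars_replace.trans (mono (Set.subset_union_left (t := t₂.vars))
        (Set.subset_union_left (t := t₂.funVars))))
      (t₂.freeVars_replace.trans (mono (Set.subset_union_right (s := t₁.vars))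
        (Set.subset_union_right (s := t₁.funVars))))
    cases c <;> exact this
  | rel R ts =>
    have := Set.iUnion_subset fun i => (ts i).freeVars_replace.trans
      (mono (Set.subset_iUnion (fun i => (ts i).vars) i)
        (Set.subset_iUnion (fun i => (ts i).funVars) i))
    cases c <;> exact this
  | relVar k ts => cases c <;> exact Set.empty_subset _
  | not φ ih => exact ih hψ
  | and φ χ ihφ ihχ =>
    have := fun c => Set.union_subset
      ((ihφ hψ.1 (c := c)).trans (mono (Set.subset_union_left (t := χ.freeVars))
        (Set.subset_union_left (t := χ.freeFunVars))))
      ((ihχ hψ.2 (c := c)).trans (mono (Set.subset_union_right (s := φ.freeVars))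
        (Set.subset_union_right (s := φ.freeFunVars))))
    cases c <;> exact this _
  | or φ χ ihφ ihχ =>
    have := fun c => Set.union_subset
      ((ihφ hψ.1 (c := c)).trans (mono (Set.subset_union_left (t := χ.freeVars))
        (Set.subset_union_left (t := χ.freeFunVars))))
      ((ihχ hψ.2 (c := c)).trans (mono (Set.subset_union_right (s := φ.freeVars))
        (Set.subset_union_right (s := φ.freeFunVars))))
    cases c <;> exact this _
  | all x φ ih => exact hψ.elim
  | ex x φ ih => exact hψ.elim
  | allFun q k φ ih => exact hψ.elim
  | exFun q k φ ih => exact hψ.elim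
  | allRel q k φ ih => exact hψ.elim
  | exRel q k φ ih => exact hψ.elim

theorem SOFormula.mem_freeFunVars_of_mem_apps {ψ : SOFormula L} (hψ : ψ.IsQF) {q k : ℕ}
    {ts : Fin q → SOTerm L} (h : ⟨q, k, ts⟩ ∈ ψ.apps) : (q, k) ∈ ψ.freeFunVars := by
  induction ψ with
  | eq t₁ t₂ => exact h.imp (fun h => ⟨ts, h⟩) fun h => ⟨ts, h⟩
  | rel R ts' =>
    obtain ⟨i, h⟩ := Set.mem_iUnion.1 h
    exact Set.mem_iUnion.2 ⟨i, ts, h⟩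
  | relVar k ts' =>
    obtain ⟨i, h⟩ := Set.mem_iUnion.1 h
    exact Set.mem_iUnion.2 ⟨i, ts, h⟩
  | not φ ih => exact ih hψ h
  | and φ χ ihφ ihχ => exact h.imp (ihφ hψ.1) (ihχ hψ.2)
  | or φ χ ihφ ihχ => exact h.imp (ihφ hψ.1) (ihχ hψ.2)
  | all x φ ih => exact hψ.elim
  | ex x φ ih => exact hψ.elim
  | allFun q k φ ih => exact hψ.elim
  | exFun q k φ ih => exact hψ.elim
  | allRel q k φ ih => exact hψ.elim
  | exRel q k φ ih => exact hψ.elim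

end Replace

/-! ### Correctness of the explicit translation -/

namespace NormalForm

variable {N : NormalForm L} {y : ℕ → ℕ}

theorem freeVars_ψ : N.ψ.freeVars ⊆ {x | x ∈ N.xs} := by
  have h := N.closed.1
  rw [SOFormula.freeVars_funPrefix] at h
  simpa [h] using SOFormula.freeVars_alls N.xs N.ψ

theorem freeRelVars_ψ : N.ψ.freeRelVars = ∅ := by
  have h := N.closed.2.2
  rwa [SOFormula.freeRelVars_funPrefix, SOFormula.freeRelVars_alls] at h

theorem exists_of_mem_freeFunVars_ψ {g : ℕ × ℕ} (hg : g ∈ N.ψ.freeFunVars) :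
    ∃ i ∈ Set.Icc 1 (2 * N.n), ∃ j, g = (N.q, N.f i j) := by
  rw [← SOFormula.freeFunVars_alls N.xs] at hg
  rcases SOFormula.freeFunVars_funPrefix N.q N.f _ (r := 2 * N.n) (i := 1) hg with
    h | ⟨i, h₁, h₂, j, e⟩
  · rw [N.closed.2.1] at h
    exact h.elim
  · exact ⟨i, ⟨h₁, by omega⟩, j, e⟩

theorem mem_us {i x : ℕ} : x ∈ N.us y i ↔ ∃ j, y (N.f i j) = x := List.mem_ofFn

theorem Fresh.injective (hy : N.Fresh y) {i : ℕ} (hi : i ∈ Set.Icc 1 (2 * N.n)) :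
    Function.Injective fun j => y (N.f i j) :=
  fun j j' h => (hy.2 i hi i hi j j' h).2

theorem Fresh.arg_notMem_us (hy : N.Fresh y) {i i' : ℕ} (hi : i ∈ Set.Icc 1 (2 * N.n))
    (hi' : i' ∈ Set.Icc 1 (2 * N.n)) (j : Fin N.p) (k : Fin N.q) :
    N.arg i' j k ∉ N.us y i := by
  rw [mem_us]
  rintro ⟨j', h⟩
  exact hy.1 i hi j' (h ▸ N.arg_mem i' hi' j k)

theorem Fresh.notMem_us_of_mem_xs (hy : N.Fresh y) {i x : ℕ} (hi : i ∈ Set.Icc 1 (2 * N.n))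
    (hx : x ∈ N.xs) : x ∉ N.us y i := by
  rw [mem_us]
  rintro ⟨j', h⟩
  exact hy.1 i hi j' (h ▸ hx)

theorem Fresh.notMem_us_of_ne (hy : N.Fresh y) {i i' : ℕ} (hi : i ∈ Set.Icc 1 (2 * N.n))
    (hi' : i' ∈ Set.Icc 1 (2 * N.n)) (hne : i' ≠ i) (j : Fin N.p) : y (N.f i' j) ∉ N.us y i := by
  rw [mem_us]
  rintro ⟨j', h⟩
  exact hne (hy.2 i' hi' i hi j j' h.symm).1

/-! ### Semantics of `δᵢ` and `φ*` -/

section Semantics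

variable {M : Type w}

/-- The team `X` represents the values in `A` of the function variables of the blocks before
block `i`, and is unrestricted on the remaining universally quantified variables. -/
structure Represents (N : NormalForm L) (y : ℕ → ℕ) (i : ℕ) (A : SOValuation M)
    (X : Set (ℕ → M)) : Prop where
  eq : ∀ i' ∈ Set.Icc 1 (2 * N.n), i' < i → ∀ j, ∀ s ∈ X,
    s (y (N.f i' j)) = A.func N.q (N.f i' j) fun k => s (N.arg i' j k)
  full : ∀ g : ℕ → M, ∃ s ∈ X, (∀ x ∈ N.xs, s x = g x) ∧
    ∀ i' ∈ Set.Icc 1 (2 * N.n), Odd i' → i ≤ i' → ∀ j, s (y (N.f i' j)) = g (y (N.f i' j))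

/-- Earlier values survive because neither their variables nor their arguments belong to block `i`,
and because the function variables of different blocks are distinct. -/
theorem Represents.succ {i : ℕ} {A : SOValuation M} {X X' : Set (ℕ → M)}
    (hX : N.Represents y i A X) (hy : N.Fresh y) (hi : i ∈ Set.Icc 1 (2 * N.n))
    {F : ℕ → (Fin N.q → M) → M} (hX' : ∀ s' ∈ X', ∃ s ∈ X, ∀ x ∉ N.us y i, s' x = s x)
    (hF : ∀ j, ∀ s ∈ X', s (y (N.f i j)) = F (N.f i j) fun k => s (N.arg i j k))
    (hfull : ∀ g : ℕ → M, ∃ s ∈ X', (∀ x ∈ N.xs, s x = g x) ∧ ∀ i' ∈ Set.Icc 1 (2 * N.n),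
      Odd i' → i + 1 ≤ i' → ∀ j, s (y (N.f i' j)) = g (y (N.f i' j))) :
    N.Represents y (i + 1) (A.overrideFunc N.q (List.ofFn (N.f i)) F) X' where
  eq i' hi' hlt j s' hs' := by
    simp only [SOValuation.overrideFunc, Function.update_self]
    rcases (Nat.lt_succ_iff.1 hlt).eq_or_lt with rfl | hlt
    · rw [override_of_mem (List.mem_ofFn.2 ⟨j, rfl⟩)]
      exact hF j s' hs'
    · rw [override_of_notMem]
      · obtain ⟨s, hs, e⟩ := hX' s' hs'
        rw [e _ (hy.notMem_us_of_ne hi hi' hlt.ne j), hX.eq i' hi' hlt j s hs]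
        simp only [e _ (hy.arg_notMem_us hi hi' j _)]
      · rw [List.mem_ofFn]
        rintro ⟨j', h⟩
        exact hlt.ne (N.f_inj i' hi' i hi j j' h.symm).1
  full := hfull

variable [L.Structure M] [Nonempty M]

/-- The functions are indexed by function variables rather than by `j`, as `overrideFunc` expects;
injectivity allows the reindexing. -/
theorem holds_theta (hinj : ∀ i ∈ Set.Icc 1 (2 * N.n), Function.Injective (N.f i)) {i : ℕ}
    (hi : i ∈ Set.Icc 1 (2 * N.n)) {D : Finset ℕ} {X : Set (ℕ → M)} :
    (N.theta y i).Holds D X ↔ ∃ F : ℕ → (Fin N.q → M) → M, ∀ j, ∀ s ∈ X,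
      s (y (N.f i j)) = F (N.f i j) fun k => s (N.arg i j k) := by
  simp only [theta, BIDFormula.holds_conj, List.forall_mem_ofFn_iff, BIDFormula.holds_dep_var]
  constructor
  · intro h
    choose F hF using h
    refine ⟨Function.extend (N.f i) F fun _ _ => Classical.arbitrary M, fun j s hs => ?_⟩
    rw [(hinj i hi).extend_apply]
    exact hF j s hs
  · exact fun ⟨F, hF⟩ j => ⟨F (N.f i j), hF j⟩

/-- Induction on the number of remaining blocks. In the end flatness of `ψ'` reduces the claim to
single assignments, and fullness makes these cover all values of `x₁, …, xₘ`. -/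
theorem holds_delta (hy : N.Fresh y) (r : ℕ) : ∀ {i : ℕ} {A : SOValuation M} {D : Finset ℕ}
    {X : Set (ℕ → M)}, 1 ≤ i → i + r = 2 * N.n + 1 → N.Represents y i A X →
      ((N.delta y r i).Holds D X ↔
        (SOFormula.funPrefix N.q N.f (SOFormula.alls N.xs N.ψ) r i).Realize A) := by
  have hinj : ∀ i ∈ Set.Icc 1 (2 * N.n), Function.Injective (N.f i) := fun i hi j j' h =>
    (N.f_inj i hi i hi j j' h).2
  induction r with
  | zero =>
    intro i A D X h1 hr hX
    have key := SOFormula.holds_replace (y := y) (D := D) (X := X) (c := true)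
      (A := fun s => { A with elem := override N.xs s A.elem }) N.qf freeRelVars_ψ
      (fun s _ x hx => override_of_mem (freeVars_ψ hx)) (by
        intro s hs q k ts h
        obtain ⟨i', hi', j, e⟩ :=
          exists_of_mem_freeFunVars_ψ (SOFormula.mem_freeFunVars_of_mem_apps N.qf h)
        obtain ⟨rfl, rfl⟩ := Prod.mk.inj e
        obtain rfl := N.uniform i' hi' j ts h
        have hi2 := hi'.2
        rw [hX.eq i' hi' (by omega) j s hs]
        simp only [SOTerm.realize, override_of_mem (N.arg_mem i' hi' j _)])
    refine key.trans (Iff.trans ?_ (SOFormula.realize_alls _ _ _).symm)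
    constructor
    · intro h a
      obtain ⟨s, hs, e, -⟩ := hX.full a
      convert! (show N.ψ.Realize _ from h s hs) using 2
      funext x
      by_cases hx : x ∈ N.xs
      · rw [override_of_mem hx, override_of_mem hx, e x hx]
      · rw [override_of_notMem hx, override_of_notMem hx]
    · exact fun h s _ => h s
  | succ r ih =>
    intro i A D X h1 hr hX
    have hi : i ∈ Set.Icc 1 (2 * N.n) := ⟨h1, by omega⟩
    have hH : ∀ F : ℕ → (Fin N.q → M) → M, ∃ H : ℕ → (ℕ → M) → M, ∀ j s,
        H (y (N.f i j)) s = F (N.f i j) fun k => s (N.arg i j k) := fun F =>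
      ⟨Function.extend (fun j => y (N.f i j)) (fun j s => F (N.f i j) fun k => s (N.arg i j k))
        fun _ _ => Classical.arbitrary M, fun j s => by rw [(hy.injective hi).extend_apply]⟩
    rw [delta, SOFormula.funPrefix]
    split_ifs with hodd
    · rw [SOFormula.realize_allFuns]
      -- The largest subteam on which block `i` has the values of `F`. It is still full: the `u` of
      -- block `i` were unrestricted in `X`, so they can be given the values that `F` prescribes.
      have hrep : ∀ F, N.Represents y (i + 1) (A.overrideFunc N.q (List.ofFn (N.f i)) F)
          {s ∈ X | ∀ j, s (y (N.f i j)) = F (N.f i j) fun k => s (N.arg i j k)} := by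
        intro F
        refine hX.succ hy hi (fun s hs => ⟨s, hs.1, fun _ _ => rfl⟩) (fun j s hs => hs.2 j) ?_
        intro g
        obtain ⟨H, hH⟩ := hH F
        obtain ⟨s, hs, hxs, hu⟩ := hX.full (override (N.us y i) (fun x => H x g) g)
        have hxs' : ∀ x ∈ N.xs, s x = g x := fun x hx => by
          rw [hxs x hx, override_of_notMem (hy.notMem_us_of_mem_xs hi hx)]
        refine ⟨s, ⟨hs, fun j => ?_⟩, hxs', fun i' hi' ho hlt j => ?_⟩
        · rw [hu i hi hodd le_rfl j, override_of_mem (mem_us.2 ⟨j, rfl⟩), hH]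
          simp only [hxs' _ (N.arg_mem i hi j _)]
        · rw [hu i' hi' ho (by omega) j,
            override_of_notMem (hy.notMem_us_of_ne hi hi' (by omega) j)]
      constructor
      · intro h F
        exact (ih (by omega) (by omega) (hrep F)).1
          (h _ (Set.sep_subset _ _) ((holds_theta hinj hi).2 ⟨F, fun j s hs => hs.2 j⟩))
      · intro h Y hY hΘ
        obtain ⟨F, hF⟩ := (holds_theta hinj hi).1 hΘ
        exact ((ih (D := D) (by omega) (by omega) (hrep F)).2 (h F)).mono
          fun s hs => ⟨hY hs, fun j => hF j s hs⟩
    · rw [SOFormula.realize_exFuns]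
      constructor
      · intro h
        obtain ⟨Y, ⟨hΘ, hδ⟩, h₁, h₂⟩ := h.exists_of_exs
        obtain ⟨F, hF⟩ := (holds_theta hinj hi).1 hΘ
        refine ⟨F, (ih (by omega) (by omega) (hX.succ hy hi h₁ hF ?_)).1 hδ⟩
        intro g
        obtain ⟨s, hs, hxs, hu⟩ := hX.full g
        obtain ⟨s', hs', e⟩ := h₂ s hs
        refine ⟨s', hs', fun x hx => ?_, fun i' hi' ho hlt j => ?_⟩
        · rw [e x (hy.notMem_us_of_mem_xs hi hx), hxs x hx]
        · rw [e _ (hy.notMem_us_of_ne hi hi' (by omega) j), hu i' hi' ho (by omega) j]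
      · rintro ⟨F, h⟩
        obtain ⟨H, hH⟩ := hH F
        have hF : ∀ j, ∀ s ∈ (fun s => override (N.us y i) (fun x => H x s) s) '' X,
            s (y (N.f i j)) = F (N.f i j) fun k => s (N.arg i j k) := by
          rintro j _ ⟨s, hs, rfl⟩
          simp only [override_of_mem (mem_us.2 ⟨j, rfl⟩), hH,
            override_of_notMem (hy.arg_notMem_us hi hi j _)]
        -- The arguments of `F` are not among the `u` of block `i`, so `H` does not see the changes
        -- made within the block.
        refine BIDFormula.holds_exs_of_image (H := H) ?_
          ⟨(holds_theta hinj hi).2 ⟨F, hF⟩, (ih (by omega) (by omega) (hX.succ hy hi ?_ hF ?_)).2 h⟩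
        · intro x hx s s' e
          obtain ⟨j, rfl⟩ := mem_us.1 hx
          simp only [hH, e _ (hy.arg_notMem_us hi hi j _)]
        · rintro _ ⟨s, hs, rfl⟩
          exact ⟨s, hs, fun x hx => override_of_notMem hx⟩
        · intro g
          obtain ⟨s, hs, hxs, hu⟩ := hX.full g
          refine ⟨_, ⟨s, hs, rfl⟩, fun x hx => ?_, fun i' hi' ho hlt j => ?_⟩
          · simp only [override_of_notMem (hy.notMem_us_of_mem_xs hi hx), hxs x hx]
          · simp only [override_of_notMem (hy.notMem_us_of_ne hi hi' (by omega : i' ≠ i) j),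
              hu i' hi' ho (by omega) j]

/-- The variables `u_{i,j}` for odd `i`. -/
theorem mem_oddVars {x : ℕ} : (x ∈ (List.range N.n).flatMap fun t => N.us y (2 * t + 1)) ↔
    ∃ i ∈ Set.Icc 1 (2 * N.n), Odd i ∧ ∃ j, y (N.f i j) = x := by
  simp only [List.mem_flatMap, List.mem_range, mem_us]
  constructor
  · rintro ⟨t, ht, j, h⟩
    exact ⟨2 * t + 1, ⟨by omega, by omega⟩, ⟨t, rfl⟩, j, h⟩
  · rintro ⟨i, ⟨-, hi⟩, ⟨t, rfl⟩, j, h⟩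
    exact ⟨t, by omega, j, h⟩

/-- After the universal quantifiers the team contains all combinations of values of the odd `u` and
the `x`. As no block precedes the first, it represents every valuation. -/
theorem trueIn_star_iff (hy : N.Fresh y) : N.toFormula.TrueIn M ↔ (N.star y).TrueIn M := by
  rw [BIDFormula.trueIn_iff, star, BIDFormula.holds_alls, BIDFormula.holds_alls]
  have key := fun (A : SOValuation M) X =>
    holds_delta (A := A) (X := X) hy (2 * N.n) (D := BIDFormula.insertList N.xs
      (BIDFormula.insertList ((List.range N.n).flatMap fun t => N.us y (2 * t + 1)) ∅))
      le_rfl (by omega)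
  have hrep : ∀ A : SOValuation M, N.Represents y 1 A {s' | ∃ s ∈ {s' | ∃ s ∈
      ({fun _ => Classical.arbitrary M} : Set (ℕ → M)), ∃ a, s' = override
        ((List.range N.n).flatMap fun t => N.us y (2 * t + 1)) a s},
          ∃ a, s' = override N.xs a s} := by
    intro A
    refine ⟨fun i' hi' hlt => absurd hi'.1 (by omega), fun g => ?_⟩
    refine ⟨_, ⟨_, ⟨_, rfl, g, rfl⟩, g, rfl⟩, fun x hx => override_of_mem hx,
      fun i hi ho _ j => ?_⟩
    rw [override_of_notMem (hy.1 i hi j), override_of_mem (mem_oddVars.2 ⟨i, hi, ho, j, rfl⟩)]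
  let a : M := Classical.arbitrary M
  exact ⟨fun h => (key ⟨fun _ => a, fun _ _ _ => a, fun _ _ _ => True⟩ _ (hrep _)).2 (h _),
    fun h A => (key A _ (hrep A)).1 h⟩

end Semantics

/-! ### The explicit translation is a sentence -/

theorem _root_.TeamLogic.BIDFormula.freeVars_conj_subset {l : List (BIDFormula L)} {V : Set ℕ}
    (h : ∀ φ ∈ l, φ.freeVars ⊆ V) : (BIDFormula.conj l).freeVars ⊆ V := by
  induction l with
  | nil => simp [BIDFormula.conj, BIDFormula.freeVars]
  | cons φ l ih =>
    cases l with
    | nil => exact h φ List.mem_cons_self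
    | cons χ l =>
      exact Set.union_subset (h φ List.mem_cons_self)
        (ih fun φ' h' => h φ' (List.mem_cons_of_mem _ h'))

theorem freeVars_theta {i : ℕ} (hi : i ∈ Set.Icc 1 (2 * N.n)) :
    (N.theta y i).freeVars ⊆ {x | x ∈ N.xs} ∪ {x | x ∈ N.us y i} := by
  refine BIDFormula.freeVars_conj_subset fun φ hφ => ?_
  obtain ⟨j, rfl⟩ := List.mem_ofFn.1 hφ
  refine Set.union_subset (Set.iUnion_subset fun k => ?_) ?_
  · simpa using Or.inl (N.arg_mem i hi j k)
  · simpa using Or.inr (mem_us.2 ⟨j, rfl⟩)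

/-- At `i = 2n + 1` all blocks are allowed, and each even block binds its own variables on the way
down. At `i = 1` only odd blocks remain, which are those bound by the outer quantifiers of `φ*`. -/
theorem freeVars_delta (r : ℕ) : ∀ {i : ℕ}, 1 ≤ i → i + r = 2 * N.n + 1 →
    (N.delta y r i).freeVars ⊆ {x | x ∈ N.xs} ∪
      {x | ∃ i' ∈ Set.Icc 1 (2 * N.n), (Odd i' ∨ i' < i) ∧ x ∈ N.us y i'} := by
  induction r with
  | zero =>
    intro i h1 hr
    refine (SOFormula.freeVars_replace N.qf).trans (Set.union_subset_union freeVars_ψ ?_)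
    rintro _ ⟨k, ⟨q, h⟩, rfl⟩
    obtain ⟨i', hi', j, e⟩ := exists_of_mem_freeFunVars_ψ h
    obtain ⟨rfl, rfl⟩ := Prod.mk.inj e
    exact ⟨i', hi', Or.inr (by have := hi'.2; omega), mem_us.2 ⟨j, rfl⟩⟩
  | succ r ih =>
    intro i h1 hr
    have hi : i ∈ Set.Icc 1 (2 * N.n) := ⟨h1, by omega⟩
    have ih := ih (i := i + 1) (by omega) (by omega)
    rw [delta]
    split_ifs with hodd
    · refine Set.union_subset ((freeVars_theta hi).trans (Set.union_subset_union_right _ ?_))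
        (ih.trans (Set.union_subset_union_right _ ?_))
      · exact fun x hx => ⟨i, hi, Or.inl hodd, hx⟩
      · rintro x ⟨i', hi', h, hx⟩
        refine ⟨i', hi', ?_, hx⟩
        rcases h with h | h
        · exact Or.inl h
        · rcases (Nat.lt_succ_iff.1 h).eq_or_lt with rfl | h
          exacts [Or.inl hodd, Or.inr h]
    · rw [BIDFormula.freeVars_exs]
      rintro x ⟨h | h, hx⟩
      · exact Or.inl ((freeVars_theta hi h).resolve_right hx)
      · refine (ih h).imp_right ?_
        rintro ⟨i', hi', h, hx'⟩
        refine ⟨i', hi', h.imp_right fun h => ?_, hx'⟩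
        refine lt_of_le_of_ne (Nat.lt_succ_iff.1 h) ?_
        rintro rfl
        exact hx hx'

theorem isSentence_star : (N.star y).IsSentence := by
  rw [BIDFormula.IsSentence, star, BIDFormula.freeVars_alls, BIDFormula.freeVars_alls,
    Set.eq_empty_iff_forall_notMem]
  rintro x ⟨⟨h, hxs⟩, hu⟩
  obtain ⟨i, hi, ho | hlt, hx⟩ := (freeVars_delta _ le_rfl (by omega) h).resolve_left hxs
  · exact hu (mem_oddVars.2 ⟨i, hi, ho, mem_us.1 hx⟩)
  · exact absurd hi.1 (by omega)

end NormalForm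

end TeamLogic

theorem mainTheorem3 (L : FirstOrder.Language.{u, v}) :
    (∀ φ : TeamLogic.SOFormula L, φ.IsSentence →
      ∃ φ' : TeamLogic.BIDFormula L, φ'.IsSentence ∧
        ∀ (M : Type w) [L.Structure M] [Nonempty M], φ.TrueIn M ↔ φ'.TrueIn M) ∧
    (∀ (N : TeamLogic.NormalForm L) (y : ℕ → ℕ), N.Fresh y →
      (N.star y).IsSentence ∧
        ∀ (M : Type w) [L.Structure M] [Nonempty M],
          N.toFormula.TrueIn M ↔ (N.star y).TrueIn M) :=
  ⟨fun _ hφ => hφ.exists_BIDFormula,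
    fun _ _ hy => ⟨TeamLogic.NormalForm.isSentence_star, fun _ _ _ =>
      TeamLogic.NormalForm.trueIn_star_iff hy⟩⟩
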